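/- Let $S^7\subset\mathbb C^4=\mathbb H^2$ be the unit sphere, on which $G=\mathrm{Sp}(2)\times\mathrm U(1)$ acts by $(A,\lambda)\cdot v=\lambda^{-1}Av$ (quaternions being realised as $2\times2$ blocks $\begin{pmatrix}\alpha&-\bar \beta\\ \beta&\bar \alpha\end{pmatrix}$), let $o=e_3$ and let $H=\mathrm{Sp}(1)\cdot\mathrm{diag}\,\mathrm U(1)$ be the isotropy group of $o$. Let $H_1,H_2,H_3,X_1,\dots,X_4,Z_1,Z_2,Z_3$ be the basis of $\mathfrak{sp}(2)$ for which $\sum h_iH_i+\sum x_iX_i+\sum z_iZ_i$ is the matrix $$\begin{pmatrix} ih_1&-h_2-ih_3&x_1+ix_2&-x_3-ix_4\\ h_2-ih_3&-ih_1&x_3-ix_4&x_1-ix_2\\ -x_1+ix_2&-x_3-ix_4&iz_1&-z_2-iz_3\\ x_3-ix_4&-x_1-ix_2&z_2-iz_3&-iz_1\end{pmatrix},$$ let $W=(Z_1,i)\in\mathfrak{sp}(2)\oplus\mathfrak u(1)$, and put $\mathfrak m=\mathrm{span}(X_1,\dots,X_4,Z_1,Z_2,Z_3)\simeq T_oS^7$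 and $\mathfrak h=\mathrm{span}(H_1,H_2,H_3,W)$, the Lie algebra of $H$. Let $\alpha_1,\alpha_2,\alpha_3$ be the restrictions to $\mathrm{span}(X_1,\dots,X_4)$, $\mathrm{span}(Z_1)$, $\mathrm{span}(Z_2,Z_3)$ of the scalar product on $\mathfrak m$ for which $X_1,\dots,Z_3$ is orthonormal, and for $c_1,c_2,c_3>0$ let $g(c_1,c_2,c_3)=c_1\alpha_1+c_2\alpha_2+c_3\alpha_3$. For a norm $F$ on $\mathfrak m$ that is invariant under $\mathrm{Ad}(H)$, a vector $Y\in\mathfrak{sp}(2)\oplus\mathfrak u(1)$ is a geodesic vector if $t\mapsto\exp(tY)\cdot o$ is a geodesic (a critical point of the energy under variations with fixed end points) of the $G$-invariant metric on $S^7$ given by $F$ at $o$. A geodesic graph is an $\mathrm{Ad}(H)$-equivariant map $\xi:\mathfrak m\to\mathfrak h$ such that $y+\xi(y)$ is a geodesic vector for every $y\ne0$. For $c=(c_1,c_2,c_3)$ with positive entries put $K_1=\frac{c_2}{c_3}-2\frac{c_2}{c_1}$, $K_2=1-2\frac{c_3}{c_1}$, $K_3=\frac{c_2}{c_3}-1$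 and, for $y=\sum x_iX_i+\sum z_iZ_i$, let $\xi^c(y)=\xi_1H_1+\xi_2H_2+\xi_3H_3+\xi_4W$ with $$\xi_1=\frac{K_1z_1(x_1^2+x_2^2-x_3^2-x_4^2)+2K_2[z_2(x_2x_3-x_1x_4)+z_3(x_1x_3+x_2x_4)]}{x_1^2+x_2^2+x_3^2+x_4^2},$$ $$\xi_2=\frac{2K_1z_1(x_2x_3+x_1x_4)+K_2[z_2(x_1^2-x_2^2+x_3^2-x_4^2)+2z_3(x_3x_4-x_1x_2)]}{x_1^2+x_2^2+x_3^2+x_4^2},$$ $$\xi_3=\frac{2K_1z_1(x_2x_4-x_1x_3)+K_2[2z_2(x_1x_2+x_3x_4)+z_3(x_1^2-x_2^2-x_3^2+x_4^2)]}{x_1^2+x_2^2+x_3^2+x_4^2},$$ $$\xi_4=K_3z_1,$$ where $\xi_1=\xi_2=\xi_3=0$ at $x=0$. Let $g_j=\sum_{i=1}^3a_{ji}\alpha_i$, $j=1,\dots,k$, with all $a_{ji}>0$, and let $F=\sqrt{L(\sqrt{g_1},\dots,\sqrt{g_k})}$ on $\mathfrak m$, where the continuous function $L$ on $[0,\infty)^k$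 is positively homogeneous of degree 2 and, at all points with positive coordinates, is smooth and positive, with $L_{,j}\ge0$ for all $j$, $\mathrm{Hess}(L)$ positive semi-definite and $L_{,1}+\dots+L_{,k}>0$. For $y\neq 0$ put $$B_j(y)=\frac{L_{,j}}{2\sqrt{g_j(y,y)}},\qquad C_i(y)=\sum_{j=1}^kB_j(y)\,a_{ji},$$ with $L_{,j}$ taken at $(\sqrt{g_1(y,y)},\dots,\sqrt{g_k(y,y)})$. Then $C_i(y)>0$ for all $y\ne0$ and $i=1,2,3$, and the map $\eta(y)=\xi^{C(y)}(y)$, with $\eta(0)=0$, is a geodesic graph of $F$, continuous on $\{x\ne0\}$ and unique in the following sense. * If $x\ne0$ and $(z_2,z_3)\ne(0,0)$, then $\zeta=\eta(y)$ is the only $\zeta\in\mathfrak h$ for which $y+\zeta$ is a geodesic vector. * Every geodesic graph of $F$ equals $\eta$ at all $y$ with $(z_2,z_3)\ne(0,0)$. * Every geodesic graph of $F$ that is continuous on $\{x\ne0\}$ equals $\eta$ at all $y$ with $x\neq0$. For constants $c_1,c_2,c_3>0$ the same holds for the Riemannian metric $g(c_1,c_2,c_3)$ with $\xi^c$ in place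 of $\eta$. Thus the geodesic graph of $F$ is obtained from that of $g(c_1,c_2,c_3)$ by replacing the constants $c_i$ with the functions $C_i(y)$. -/

import Mathlib

open scoped Matrix ContDiff

noncomputable section

namespace SevenSphere

/-! ### The group `Sp(2) × U(1)`, its action on `S⁷ ⊂ ℂ⁴ = ℍ²`, and its Lie algebra -/

/-- The ambient space `ℂ⁴ = ℍ²`. -/
abbrev V : Type := Fin 4 → ℂ

/-- The unit sphere `S⁷` of `ℂ⁴`. -/
def sphere : Set V := {v | ∑ i, ‖v i‖ ^ 2 = 1}

/-- The origin of `S⁷`: the third vector of the standard basis of `ℂ⁴`. -/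
def origin : V := Pi.single 2 1

/-- The matrix of the symplectic form of `ℂ⁴ = ℍ²` for which quaternions are
realised as the `2 × 2` blocks `!![a, -conj b; b, conj a]`. -/
def J : Matrix (Fin 4) (Fin 4) ℂ :=
  !![0, -1, 0, 0;
     1, 0, 0, 0;
     0, 0, 0, -1;
     0, 0, 1, 0]

/-- `G = Sp(2) × U(1)`, where `Sp(2) = U(4) ∩ Sp(4, ℂ)`. -/
def G : Set (Matrix (Fin 4) (Fin 4) ℂ × ℂ) :=
  {σ | σ.1 ∈ Matrix.unitaryGroup (Fin 4) ℂ ∧ σ.1ᵀ * J * σ.1 = J ∧ ‖σ.2‖ = 1}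

/-- The action of `Sp(2) × U(1)` on `ℂ⁴`: `(A, λ) · v = λ⁻¹ A v`. -/
def act (σ : Matrix (Fin 4) (Fin 4) ℂ × ℂ) (v : V) : V := σ.2⁻¹ • (σ.1 *ᵥ v)

/-- The isotropy group `H = Sp(1) · diag U(1)` of the origin. -/
def H : Set (Matrix (Fin 4) (Fin 4) ℂ × ℂ) := {σ | σ ∈ G ∧ act σ origin = origin}

/-- The ambient space of the Lie algebra `sp(2) ⊕ u(1)`; the pair `(Y, r)` stands for
the element with `sp(2)`-part `Y` and `u(1)`-part `i r`. -/
abbrev LieAmbient : Type := Matrix (Fin 4) (Fin 4) ℂ × ℝ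

/-- The adjoint representation of `Sp(2) × U(1)`. -/
def Ad (σ : Matrix (Fin 4) (Fin 4) ℂ × ℂ) (Y : LieAmbient) : LieAmbient :=
  (σ.1 * Y.1 * σ.1⁻¹, Y.2)

/-- The infinitesimal action at `v`: the velocity at `t = 0` of `t ↦ exp (t Y) · v`. -/
def infAct (Y : LieAmbient) (v : V) : V := Y.1 *ᵥ v - (Complex.I * Y.2) • v

/-- The orbit `t ↦ exp (t Y) · o` of the origin `o`. -/
def orbit (Y : LieAmbient) (t : ℝ) : V :=
  act (NormedSpace.exp (t • Y.1), Complex.exp (t * (Complex.I * Y.2))) origin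

/-- The matrix `h₁ H₁ + h₂ H₂ + h₃ H₃ + x₁ X₁ + ⋯ + x₄ X₄ + z₁ Z₁ + z₂ Z₂ + z₃ Z₃`
in `sp(2)`. -/
def spMatrix (h : Fin 3 → ℝ) (x : Fin 4 → ℝ) (z : Fin 3 → ℝ) : Matrix (Fin 4) (Fin 4) ℂ :=
  !![Complex.I * h 0, -h 1 - Complex.I * h 2, x 0 + Complex.I * x 1, -x 2 - Complex.I * x 3;
     h 1 - Complex.I * h 2, -Complex.I * h 0, x 2 - Complex.I * x 3, x 0 - Complex.I * x 1;
     -x 0 + Complex.I * x 1, -x 2 - Complex.I * x 3, Complex.I * z 0, -z 1 - Complex.I * z 2;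
     x 2 - Complex.I * x 3, -x 0 - Complex.I * x 1, z 1 - Complex.I * z 2, -Complex.I * z 0]

/-- Coordinates `y = (x, z)` on the reductive complement `𝔪`,
with respect to its basis `X₁, …, X₄, Z₁, Z₂, Z₃`. -/
abbrev M : Type := (Fin 4 → ℝ) × (Fin 3 → ℝ)

/-- The vector `x₁ X₁ + ⋯ + x₄ X₄ + z₁ Z₁ + z₂ Z₂ + z₃ Z₃` of `𝔪`. -/
def mVec (y : M) : LieAmbient := (spMatrix 0 y.1 y.2, 0)

/-- The vector `ξ₁ H₁ + ξ₂ H₂ + ξ₃ H₃ + ξ₄ W` of the isotropy algebra `𝔥`. Here `W = (Z₁, i)`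
generates `diag u(1)`: it annihilates the origin and acts on `𝔪` as `ad Z₁`. -/
def hVec (ξ : Fin 4 → ℝ) : LieAmbient := (spMatrix ![ξ 0, ξ 1, ξ 2] 0 ![ξ 3, 0, 0], ξ 3)

/-! ### Homogeneous Finsler metrics, geodesics and geodesic graphs -/

open Classical in
/-- The `G`-invariant function on the tangent bundle of `S⁷` that is determined by the
`Ad(H)`-invariant function `F` on `𝔪 ≃ T_o S⁷` through `F_q (σ_* y) = F y` for `σ · o = q`
(and, by convention, zero at pairs `(q, v)` that are not tangent vectors of `S⁷`). -/
def homogeneousMetric (F : M → ℝ) (q v : V) : ℝ :=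
  if h : ∃ y : M, ∃ σ ∈ G, act σ origin = q ∧ act σ (infAct (mVec y) origin) = v then
    F h.choose
  else 0

/-- `γ` is a geodesic of the homogeneous metric determined by `F`: a smooth curve in `S⁷` that is
a critical point of the energy on every compact interval, with respect to all smooth variations
in `S⁷` with fixed end points. -/
def IsGeodesic (F : M → ℝ) (γ : ℝ → V) : Prop :=
  ContDiff ℝ ∞ γ ∧ (∀ t, γ t ∈ sphere) ∧
    ∀ a b : ℝ, a < b → ∀ c : ℝ → ℝ → V,
      ContDiff ℝ ∞ (Function.uncurry c) →
      (∀ s t, c s t ∈ sphere) →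
      (∀ t, c 0 t = γ t) →
      (∀ s, c s a = γ a) → (∀ s, c s b = γ b) →
      HasDerivAt (fun s => ∫ t in a..b, homogeneousMetric F (c s t) (deriv (c s) t) ^ 2) 0 0

/-- `Y` is a geodesic vector: the orbit `exp (t Y) · o` is a geodesic. -/
def IsGeodesicVector (F : M → ℝ) (Y : LieAmbient) : Prop := IsGeodesic F (orbit Y)

/-- A geodesic graph: an `Ad(H)`-equivariant map `ξ : 𝔪 → 𝔥` such that `y + ξ y` is a geodesic
vector for every nonzero `y` in `𝔪`. -/
def IsGeodesicGraph (F : M → ℝ) (ξ : M → Fin 4 → ℝ) : Prop :=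
  (∀ σ ∈ H, ∀ y y' : M, Ad σ (mVec y) = mVec y' → Ad σ (hVec (ξ y)) = hVec (ξ y')) ∧
    ∀ y : M, y ≠ 0 → IsGeodesicVector F (mVec y + hVec (ξ y))

/-- `η` is a geodesic graph of `F`, continuous on `{x ≠ 0}`, and it is unique in the following
sense: where `x ≠ 0` and `(z₂, z₃) ≠ (0, 0)`, the value `η y` is the only vector `ζ` of `𝔥` for
which `y + ζ` is a geodesic vector; every geodesic graph equals `η` where `(z₂, z₃) ≠ (0, 0)`; and
every geodesic graph that is continuous on `{x ≠ 0}` equals `η` on `{x ≠ 0}`. -/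
def IsUniqueGeodesicGraph (F : M → ℝ) (η : M → Fin 4 → ℝ) : Prop :=
  IsGeodesicGraph F η ∧
    ContinuousOn η {y | y.1 ≠ 0} ∧
    (∀ y : M, y.1 ≠ 0 → (y.2 1 ≠ 0 ∨ y.2 2 ≠ 0) →
      ∀ ζ : Fin 4 → ℝ, IsGeodesicVector F (mVec y + hVec ζ) → ζ = η y) ∧
    ∀ ξ : M → Fin 4 → ℝ, IsGeodesicGraph F ξ →
      (∀ y : M, (y.2 1 ≠ 0 ∨ y.2 2 ≠ 0) → ξ y = η y) ∧
      (ContinuousOn ξ {y | y.1 ≠ 0} → ∀ y : M, y.1 ≠ 0 → ξ y = η y)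

/-! ### The metrics -/

/-- The quadratic forms `α₁`, `α₂`, `α₃`: the restrictions to `𝔪₁ = span (X₁, …, X₄)`,
`𝔪₂ = span (Z₁)`, `𝔪₃ = span (Z₂, Z₃)` of the scalar product in which the basis is
orthonormal, evaluated at the projections of `y`. -/
def alpha (i : Fin 3) (y : M) : ℝ :=
  ![y.1 0 ^ 2 + y.1 1 ^ 2 + y.1 2 ^ 2 + y.1 3 ^ 2, y.2 0 ^ 2, y.2 1 ^ 2 + y.2 2 ^ 2] i

/-- The quadratic form of the scalar product `g(c₁, c₂, c₃) = c₁ α₁ + c₂ α₂ + c₃ α₃`. -/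
def gForm (c : Fin 3 → ℝ) (y : M) : ℝ := ∑ i, c i * alpha i y

/-- The norm of the Riemannian metric `g(c₁, c₂, c₃)`. -/
def riemannianNorm (c : Fin 3 → ℝ) (y : M) : ℝ := √(gForm c y)

/-- The partial derivative `L_{,j}`. -/
def partialDeriv {k : ℕ} (L : (Fin k → ℝ) → ℝ) (j : Fin k) (t : Fin k → ℝ) : ℝ :=
  fderiv ℝ L t (Pi.single j 1)

/-- The conditions on `L`. Only points with positive coordinates matter for
smoothness and derivatives, as the norms of a nonzero vector are positive. -/
structure IsAdmissible {k : ℕ} (L : (Fin k → ℝ) → ℝ) : Prop where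
  continuousOn : ContinuousOn L {t | ∀ j, 0 ≤ t j}
  contDiffOn : ContDiffOn ℝ ∞ L {t | ∀ j, 0 < t j}
  pos : ∀ t : Fin k → ℝ, (∀ j, 0 < t j) → 0 < L t
  homogeneous : ∀ t : Fin k → ℝ, (∀ j, 0 ≤ t j) → ∀ r : ℝ, 0 < r → L (r • t) = r ^ 2 * L t
  partialDeriv_nonneg : ∀ t : Fin k → ℝ, (∀ j, 0 < t j) → ∀ j, 0 ≤ partialDeriv L j t
  hessian_nonneg : ∀ t : Fin k → ℝ, (∀ j, 0 < t j) →
    ∀ v : Fin k → ℝ, 0 ≤ iteratedFDeriv ℝ 2 L t ![v, v]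
  sum_partialDeriv_pos : ∀ t : Fin k → ℝ, (∀ j, 0 < t j) → 0 < ∑ j, partialDeriv L j t

/-- The tuple `(√g₁(y), …, √g_k(y))`, where `g_j = a_{j1} α₁ + a_{j2} α₂ + a_{j3} α₃`. -/
def norms {k : ℕ} (a : Fin k → Fin 3 → ℝ) (y : M) : Fin k → ℝ := fun j => riemannianNorm (a j) y

/-- The Minkowski norm `F = √L(√g₁, …, √g_k)` on `𝔪`. -/
def finslerNorm {k : ℕ} (L : (Fin k → ℝ) → ℝ) (a : Fin k → Fin 3 → ℝ) (y : M) : ℝ :=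
  √(L (norms a y))

/-- `B_j(y) = L_{,j} / (2 √g_j(y))`, with `L_{,j}` taken at `(√g₁(y), …, √g_k(y))`. -/
def coeffB {k : ℕ} (L : (Fin k → ℝ) → ℝ) (a : Fin k → Fin 3 → ℝ) (y : M) (j : Fin k) : ℝ :=
  partialDeriv L j (norms a y) / (2 * norms a y j)

/-- `C_i(y) = ∑ j, B_j(y) a_{ji}`. -/
def coeffC {k : ℕ} (L : (Fin k → ℝ) → ℝ) (a : Fin k → Fin 3 → ℝ) (y : M) : Fin 3 → ℝ :=
  fun i => ∑ j, coeffB L a y j * a j i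

/-! ### The explicit formulas -/

/-- `K₁ = c₂ / c₃ - 2 c₂ / c₁`. -/
def K₁ (c : Fin 3 → ℝ) : ℝ := c 1 / c 2 - 2 * (c 1 / c 0)

/-- `K₂ = 1 - 2 c₃ / c₁`. -/
def K₂ (c : Fin 3 → ℝ) : ℝ := 1 - 2 * (c 2 / c 0)

/-- `K₃ = c₂ / c₃ - 1`. -/
def K₃ (c : Fin 3 → ℝ) : ℝ := c 1 / c 2 - 1

/-- The explicit components `ξ₁, …, ξ₄`. At `x = 0` the convention `a / 0 = 0` makes
`ξ₁ = ξ₂ = ξ₃ = 0` there. -/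
def explicitGraph (c : Fin 3 → ℝ) (y : M) : Fin 4 → ℝ :=
  let x₁ := y.1 0
  let x₂ := y.1 1
  let x₃ := y.1 2
  let x₄ := y.1 3
  let z₁ := y.2 0
  let z₂ := y.2 1
  let z₃ := y.2 2
  ![(K₁ c * z₁ * (x₁ ^ 2 + x₂ ^ 2 - x₃ ^ 2 - x₄ ^ 2)
        + 2 * K₂ c * (z₂ * (x₂ * x₃ - x₁ * x₄) + z₃ * (x₁ * x₃ + x₂ * x₄)))
      / (x₁ ^ 2 + x₂ ^ 2 + x₃ ^ 2 + x₄ ^ 2),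
    (2 * K₁ c * z₁ * (x₂ * x₃ + x₁ * x₄)
        + K₂ c * (z₂ * (x₁ ^ 2 - x₂ ^ 2 + x₃ ^ 2 - x₄ ^ 2) + 2 * z₃ * (x₃ * x₄ - x₁ * x₂)))
      / (x₁ ^ 2 + x₂ ^ 2 + x₃ ^ 2 + x₄ ^ 2),
    (2 * K₁ c * z₁ * (x₂ * x₄ - x₁ * x₃)
        + K₂ c * (2 * z₂ * (x₁ * x₂ + x₃ * x₄) + z₃ * (x₁ ^ 2 - x₂ ^ 2 - x₃ ^ 2 + x₄ ^ 2)))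
      / (x₁ ^ 2 + x₂ ^ 2 + x₃ ^ 2 + x₄ ^ 2),
    K₃ c * z₁]

end SevenSphere

end

open scoped Matrix ContDiff

noncomputable section

namespace SevenSphere

/-! On a tangent vector `v` at `q`, the functions `|⟨q, v⟩|²`, `|ω(q, v)|²` and `|v|² - |⟨q, v⟩|² -
|ω(q, v)|²`, with `ω` the symplectic form, are `G`-invariant and restrict at the origin to `α₂`,
`α₃`, `α₁`. Each metric in question has a square of the form `φ(α₁, α₂, α₃)`, so by transitivity its
energy density is `φ ∘ invariant`, defined on all of `ℂ⁴ × ℂ⁴` (`homogeneousMetric_sq`).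

A variation of the orbit `exp(tY)·o` is pulled back by the flow of `Y` to a variation `u` of the
constant curve `o`. The density becomes `φ(invariant(u, ∂ₜu + Yu))`, and its differential `D` at `s
= 0` does not depend on `t`. With `w = ∂ₛu` the first variation is `∫ D(w, w' + Yw)`; the term in
`w'` is a boundary term and vanishes (`hasDerivAt_energy`). Hence `Y` is a geodesic vector iff the
linear form `w ↦ D(w, Yw)` vanishes on `T_o S⁷`.

In coordinates this is a system of six equations, affine in the unknown element of `𝔥`, into which
the metric enters only through the partial derivatives `C_i = ∂φ/∂α_i` at `y`
(`isGeodesicVector_iff`). For `g(c₁, c₂, c₃)` these are the constants `c_i`; for `F` the chain rule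
gives the functions `C_i(y)` (`fderiv_profile`). This is why replacing `c_i` by `C_i(y)` turns one
geodesic graph into the other.

Two equations determine `ξ₄` unless `z₂ = z₃ = 0`; the other four then determine `ξ₁, ξ₂, ξ₃` if `x
≠ 0`. The gaps are filled by equivariance under `Sp(1)` at `x = 0` and by continuity at `z₂ = z₃ =
0`. Equivariance of the explicit solution follows from a coordinate-free matrix formula for it. -/

/-! ### Differentiation under the integral sign -/

/-- A function that is `C¹` on a neighbourhood of `{0} × [a, b]` may be differentiated under the
integral sign. -/
theorem hasDerivAt_intervalIntegral_of_contDiffOn {f : ℝ × ℝ → ℝ} {N : Set (ℝ × ℝ)}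
    (hN : IsOpen N) (hf : ContDiffOn ℝ 1 f N) {a b : ℝ} (hab : a ≤ b)
    (hsub : ∀ t ∈ Set.Icc a b, ((0 : ℝ), t) ∈ N) :
    HasDerivAt (fun s => ∫ t in a..b, f (s, t)) (∫ t in a..b, fderiv ℝ f (0, t) (1, 0)) 0 := by
  -- Compactness of `[a, b]` gives a strip around `s = 0` inside `N`. In the application `φ` is
  -- smooth only away from zero velocity, so nothing is known for large `s`.
  obtain ⟨u, v, hu, -, h0u, hv, huv⟩ := generalized_tube_lemma (isCompact_singleton (x := (0 : ℝ)))
    (isCompact_Icc (a := a) (b := b)) hN (by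
      rintro ⟨s, t⟩ ⟨hs, ht⟩
      obtain rfl : s = 0 := hs
      exact hsub t ht)
  obtain ⟨ε, hε, hεu⟩ := Metric.isOpen_iff.1 hu 0 (h0u rfl)
  have hmem : ∀ s ∈ Metric.closedBall (0 : ℝ) (ε / 2), ∀ t ∈ Set.Icc a b, (s, t) ∈ N :=
    fun s hs t ht => huv ⟨hεu (Metric.closedBall_subset_ball (by linarith) hs), hv ht⟩
  have hd : ContinuousOn (fun p => fderiv ℝ f p (1, 0)) N :=
    (hf.continuousOn_fderiv_of_isOpen hN le_rfl).clm_apply continuousOn_const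
  obtain ⟨K, hK⟩ := ((isCompact_closedBall (0 : ℝ) (ε / 2)).prod
    (isCompact_Icc (a := a) (b := b))).exists_bound_of_continuousOn
    (hd.mono fun p hp => hmem p.1 hp.1 p.2 hp.2)
  have hIcc : Set.uIoc a b ⊆ Set.Icc a b := by
    rw [Set.uIoc_of_le hab]; exact Set.Ioc_subset_Icc_self
  have hcont : ∀ s ∈ Metric.closedBall (0 : ℝ) (ε / 2), ∀ g : ℝ × ℝ → ℝ, ContinuousOn g N →
      ContinuousOn (fun t => g (s, t)) (Set.Icc a b) := fun s hs g hg =>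
    hg.comp (by fun_prop) (fun t ht => hmem s hs t ht)
  have h0 : (0 : ℝ) ∈ Metric.closedBall (0 : ℝ) (ε / 2) :=
    Metric.mem_closedBall_self (by linarith)
  have hmeas : ∀ s ∈ Metric.closedBall (0 : ℝ) (ε / 2), ∀ g : ℝ × ℝ → ℝ, ContinuousOn g N →
      MeasureTheory.AEStronglyMeasurable (fun t => g (s, t))
        (MeasureTheory.volume.restrict (Set.uIoc a b)) := fun s hs g hg =>
    ((hcont s hs g hg).aestronglyMeasurable measurableSet_Icc).mono_set hIcc
  refine (intervalIntegral.hasDerivAt_integral_of_dominated_loc_of_deriv_le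
    (F := fun s t => f (s, t)) (F' := fun s t => fderiv ℝ f (s, t) (1, 0))
    (bound := fun _ => K) (Metric.ball_mem_nhds (0 : ℝ) (half_pos hε)) ?_ ?_ ?_ ?_ ?_ ?_).2
  · filter_upwards [Metric.closedBall_mem_nhds (0 : ℝ) (half_pos hε)] with s hs
    exact hmeas s hs f hf.continuousOn
  · refine ContinuousOn.intervalIntegrable ?_
    rw [Set.uIcc_of_le hab]
    exact hcont 0 h0 f hf.continuousOn
  · exact hmeas 0 h0 _ hd
  · exact Filter.Eventually.of_forall fun t ht s hs =>
      hK (s, t) ⟨Metric.ball_subset_closedBall hs, hIcc ht⟩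
  · exact intervalIntegrable_const
  · refine Filter.Eventually.of_forall fun t ht s hs => ?_
    have hp := hmem s (Metric.ball_subset_closedBall hs) t (hIcc ht)
    have hfd : HasFDerivAt f (fderiv ℝ f (s, t)) (s, t) :=
      ((hf.contDiffAt (hN.mem_nhds hp)).differentiableAt one_ne_zero).hasFDerivAt
    exact hfd.comp_hasDerivAt s ((hasDerivAt_id s).prodMk (hasDerivAt_const s t))

/-! ### Invariants of tangent vectors -/

/-- The Hermitian form of `ℂ⁴`. -/
def herm (q v : V) : ℂ := star q ⬝ᵥ v

/-- The symplectic form of `ℂ⁴`. -/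
def sympl (q v : V) : ℂ := q ⬝ᵥ (J *ᵥ v)

theorem herm_eq (q v : V) : herm q v = star (q 0) * v 0 + star (q 1) * v 1 + star (q 2) * v 2
    + star (q 3) * v 3 := by
  simp [herm, dotProduct, Fin.sum_univ_four]

theorem sympl_eq (q v : V) : sympl q v = q 1 * v 0 - q 0 * v 1 + q 3 * v 2 - q 2 * v 3 := by
  simp [sympl, J, dotProduct, Matrix.mulVec, Fin.sum_univ_four]
  ring

/-- The invariant functions on pairs `(q, v)` that extend `α₁`, `α₂`, `α₃`. -/
def invariant (q v : V) : Fin 3 → ℝ :=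
  ![(herm v v).re - Complex.normSq (herm q v) - Complex.normSq (sympl q v),
    Complex.normSq (herm q v), Complex.normSq (sympl q v)]

theorem herm_act {σ : Matrix (Fin 4) (Fin 4) ℂ × ℂ} (hσ : σ ∈ G) (q v : V) :
    herm (act σ q) (act σ v) = herm q v := by
  obtain ⟨h1, -, h3⟩ := hσ
  have h1' : (σ.1)ᴴ * σ.1 = 1 := (Matrix.mem_unitaryGroup_iff').1 h1
  have h3' : star σ.2⁻¹ * σ.2⁻¹ = 1 := by
    rw [Complex.star_def, Complex.conj_mul', norm_inv, h3]; simp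
  rw [herm, act, act, star_smul, smul_dotProduct, dotProduct_smul, smul_smul, h3', one_smul,
    Matrix.star_mulVec, ← Matrix.dotProduct_mulVec, Matrix.mulVec_mulVec, h1',
    Matrix.one_mulVec, herm]

/-- The factor `λ⁻²` has modulus one, so only the absolute value of the symplectic form is
`G`-invariant. -/
theorem sympl_act {σ : Matrix (Fin 4) (Fin 4) ℂ × ℂ} (hσ : σ ∈ G) (q v : V) :
    sympl (act σ q) (act σ v) = σ.2⁻¹ * σ.2⁻¹ * sympl q v := by
  obtain ⟨-, h2, -⟩ := hσ
  rw [sympl, act, act, smul_dotProduct, Matrix.mulVec_smul, dotProduct_smul, smul_smul,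
    ← Matrix.vecMul_transpose, ← Matrix.dotProduct_mulVec, Matrix.mulVec_mulVec,
    Matrix.mulVec_mulVec, h2, smul_eq_mul, sympl]

theorem invariant_act {σ : Matrix (Fin 4) (Fin 4) ℂ × ℂ} (hσ : σ ∈ G) (q v : V) :
    invariant (act σ q) (act σ v) = invariant q v := by
  have h : Complex.normSq σ.2 = 1 := by rw [Complex.normSq_eq_norm_sq, hσ.2.2, one_pow]
  simp [invariant, herm_act hσ, sympl_act hσ, h]

theorem mem_sphere_iff (q : V) : q ∈ sphere ↔ herm q q = 1 := by
  have : herm q q = ((∑ i, ‖q i‖ ^ 2 : ℝ) : ℂ) := by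
    simp [herm_eq, Fin.sum_univ_four, Complex.conj_mul']
  rw [this]
  exact_mod_cast Iff.rfl

theorem origin_eq : origin = ![0, 0, 1, 0] := by
  ext i; fin_cases i <;> simp [origin]

theorem origin_mem_sphere : origin ∈ sphere := by
  simp [mem_sphere_iff, herm_eq, origin_eq]

/-- `mVec y` acts at the origin by its third column. -/
theorem infAct_mVec (y : M) : infAct (mVec y) origin =
    ![y.1 0 + Complex.I * y.1 1, y.1 2 - Complex.I * y.1 3, Complex.I * y.2 0,
      y.2 1 - Complex.I * y.2 2] := by
  ext i
  fin_cases i <;>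
    simp [infAct, mVec, spMatrix, origin_eq]

/-- The isotropy algebra annihilates the origin, so the `𝔥`-component does not affect the initial
velocity of the orbit. -/
theorem infAct_mVec_add_hVec (y : M) (ξ : Fin 4 → ℝ) :
    infAct (mVec y + hVec ξ) origin = infAct (mVec y) origin := by
  ext i
  fin_cases i <;>
    simp [infAct, mVec, hVec, spMatrix, origin_eq]

theorem invariant_origin (y : M) :
    invariant origin (infAct (mVec y) origin) = fun i => alpha i y := by
  rw [infAct_mVec, origin_eq]
  ext i
  fin_cases i <;>
    simp [invariant, alpha, herm_eq, sympl_eq, Complex.normSq_apply] <;>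
    ring

/-- The condition on `w` describes `T_o S⁷`; the coordinates are read off from `infAct_mVec`. -/
theorem exists_infAct_eq {w : V} (hw : (w 2).re = 0) : ∃ y : M, infAct (mVec y) origin = w := by
  refine ⟨(![(w 0).re, (w 0).im, (w 1).re, -(w 1).im], ![(w 2).im, (w 3).re, -(w 3).im]), ?_⟩
  rw [infAct_mVec]
  ext i
  fin_cases i <;> apply Complex.ext <;> simp [hw]

/-! ### Transitivity of the action -/

/-- Every unit vector of `ℍ²` has a unit vector orthogonal to its quaternionic line. -/
theorem exists_orthogonal {q : V} (hq : herm q q = 1) :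
    ∃ w : V, herm w w = 1 ∧ herm q w = 0 ∧ sympl q w = 0 := by
  set n : ℝ := Complex.normSq (q 0) + Complex.normSq (q 1) with hn
  have hn' : (n : ℂ) = star (q 0) * q 0 + star (q 1) * q 1 := by
    simp [hn, Complex.normSq_eq_conj_mul_self]
  rw [herm_eq] at hq
  by_cases h0 : n = 0
  · have h1 : q 0 = 0 := Complex.normSq_eq_zero.1 (by
      linarith [Complex.normSq_nonneg (q 0), Complex.normSq_nonneg (q 1)])
    have h2 : q 1 = 0 := Complex.normSq_eq_zero.1 (by
      linarith [Complex.normSq_nonneg (q 0), Complex.normSq_nonneg (q 1)])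
    exact ⟨![1, 0, 0, 0], by simp [herm_eq], by simp [herm_eq, h1], by simp [sympl_eq, h2]⟩
  · have hpos : 0 < n := lt_of_le_of_ne
      (add_nonneg (Complex.normSq_nonneg _) (Complex.normSq_nonneg _)) (Ne.symm h0)
    have hs : ((√n : ℝ) : ℂ) * (√n : ℝ) = n := by
      rw [← Complex.ofReal_mul, Real.mul_self_sqrt hpos.le]
    have hs0 : ((√n : ℝ) : ℂ) ≠ 0 := by
      exact_mod_cast (Real.sqrt_pos.2 hpos).ne'
    generalize hr : ((√n : ℝ) : ℂ) = r at hs hs0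
    have hrs : (starRingEnd ℂ) r = r := by rw [← hr, Complex.conj_ofReal]
    simp only [Complex.star_def] at hn' hq
    -- Writing `q = (p, s)` with quaternions `p`, `s`, this is `(-p s̄ / |p|, |p|)`, which is
    -- orthogonal to `q` over `ℍ` and has square norm `|s|² + |p|² = 1`.
    refine ⟨![-(q 0 * (starRingEnd ℂ) (q 2) + (starRingEnd ℂ) (q 1) * q 3) / r,
      -(q 1 * (starRingEnd ℂ) (q 2) - (starRingEnd ℂ) (q 0) * q 3) / r,
      r, 0], ?_, ?_, ?_⟩
    · simp [herm_eq, hrs]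
      field_simp
      have h4 : r ^ 4 = n ^ 2 := by rw [← hs]; ring
      rw [h4, pow_two r, hs, hn']
      linear_combination ((starRingEnd ℂ) (q 0) * q 0 + (starRingEnd ℂ) (q 1) * q 1) * hq
    · simp [herm_eq]
      field_simp
      rw [pow_two, hs, hn']
      ring
    · simp [sympl_eq]
      field_simp
      rw [pow_two, hs, hn']
      ring

theorem exists_act_origin_eq {q : V} (hq : q ∈ sphere) : ∃ σ ∈ G, act σ origin = q := by
  rw [mem_sphere_iff] at hq
  obtain ⟨w, h1, h2, h3⟩ := exists_orthogonal hq
  -- The columns are `w`, `J w̄`, `q`, `J q̄`: a quaternionic orthonormal basis with `q` in the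
  -- place of the origin.
  set A : Matrix (Fin 4) (Fin 4) ℂ :=
    !![w 0, -star (w 1), q 0, -star (q 1);
       w 1, star (w 0), q 1, star (q 0);
       w 2, -star (w 3), q 2, -star (q 3);
       w 3, star (w 2), q 3, star (q 2)] with hA
  have h2' := congrArg star h2
  have h3' := congrArg star h3
  simp only [herm_eq, sympl_eq, star_add, star_sub, star_mul', star_zero,
    Complex.star_def] at hq h1 h2 h3 h2' h3'
  simp only [Complex.star_def, Complex.conj_conj] at hA hq h1 h2 h3 h2' h3'
  have hU : Aᴴ * A = 1 := by
    ext i j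
    fin_cases i <;> fin_cases j <;>
      simp [hA, Matrix.mul_apply, Fin.sum_univ_four] <;>
      first
      | ring1
      | linear_combination h1
      | linear_combination hq
      | linear_combination h2
      | linear_combination h2'
      | linear_combination h3
      | linear_combination h3'
      | linear_combination -h3
      | linear_combination -h3'
  -- `A` commutes with the quaternionic structure `v ↦ J v̄`; for a unitary matrix this amounts to
  -- `Aᵀ J A = J`.
  have hAJ : A * J = J * A.map star := by
    ext i j
    fin_cases i <;> fin_cases j <;> simp [hA, J, Matrix.mul_apply, Fin.sum_univ_four]
  have hJJ : J * J = -1 := by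
    ext i j
    fin_cases i <;> fin_cases j <;> simp [J, Matrix.mul_apply, Fin.sum_univ_four]
  have hJA : J * A = A.map star * J := by
    have : J * (A * J) * J = J * (J * A.map star) * J := by rw [hAJ]
    simp only [Matrix.mul_assoc, hJJ] at this
    rw [← Matrix.mul_assoc, ← Matrix.mul_assoc, hJJ] at this
    simpa using this
  have hT : Aᵀ * A.map star = 1 := by
    have := congrArg Matrix.transpose (hU)
    rw [Matrix.transpose_mul] at this
    simpa [Matrix.conjTranspose, Matrix.transpose_map] using this
  refine ⟨(A, 1), ⟨(Matrix.mem_unitaryGroup_iff').2 hU, ?_, by simp⟩, ?_⟩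
  · rw [Matrix.mul_assoc, hJA, ← Matrix.mul_assoc, hT, Matrix.one_mul]
  · ext i
    fin_cases i <;> simp [act, hA, origin_eq]

theorem exists_act_infAct_eq {q v : V} (hq : q ∈ sphere) (hv : (herm q v).re = 0) :
    ∃ y : M, ∃ σ ∈ G, act σ origin = q ∧ act σ (infAct (mVec y) origin) = v := by
  obtain ⟨σ, hσ, rfl⟩ := exists_act_origin_eq hq
  have h2 : σ.2 ≠ 0 := fun h => by simpa [h] using hσ.2.2
  have hinv : act σ (σ.2 • (σ.1ᴴ *ᵥ v)) = v := by
    rw [act, Matrix.mulVec_smul, smul_smul, inv_mul_cancel₀ h2, one_smul, Matrix.mulVec_mulVec,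
      ← Matrix.star_eq_conjTranspose, (Matrix.mem_unitaryGroup_iff).1 hσ.1, Matrix.one_mulVec]
  rw [← hinv, herm_act hσ] at hv
  obtain ⟨y, hy⟩ := exists_infAct_eq (w := σ.2 • (σ.1ᴴ *ᵥ v))
    (by simpa [herm_eq, origin_eq] using hv)
  exact ⟨y, σ, hσ, rfl, by rw [hy, hinv]⟩

/-- A homogeneous metric whose square is a function `φ` of `α₁, α₂, α₃` has the square
`φ ∘ invariant`. -/
theorem homogeneousMetric_sq {F : M → ℝ} {φ : (Fin 3 → ℝ) → ℝ}
    (hF : ∀ y, F y ^ 2 = φ (fun i => alpha i y)) {q v : V} (hq : q ∈ sphere)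
    (hv : (herm q v).re = 0) : homogeneousMetric F q v ^ 2 = φ (invariant q v) := by
  have h := exists_act_infAct_eq hq hv
  rw [homogeneousMetric, dif_pos h, hF, ← invariant_origin]
  obtain ⟨σ, hσ, h1, h2⟩ := h.choose_spec
  rw [← invariant_act hσ, h1, h2]

/-! ### One-parameter subgroups -/

/-- The one-parameter group of linear maps `v ↦ exp (t Y) · v` of `ℂ⁴`. -/
def flow (Y : LieAmbient) (t : ℝ) : Matrix (Fin 4) (Fin 4) ℂ :=
  (Complex.exp (t * (Complex.I * Y.2)))⁻¹ • NormedSpace.exp (t • Y.1)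

/-- The generator of `flow Y`. -/
def generator (Y : LieAmbient) : Matrix (Fin 4) (Fin 4) ℂ := Y.1 - (Complex.I * Y.2) • 1

/-- The conditions for `Y` to be in the Lie algebra `sp(2) ⊕ u(1)`. -/
def IsInLieAlgebra (Y : LieAmbient) : Prop := Y.1ᴴ = -Y.1 ∧ Y.1ᵀ * J = -(J * Y.1)

theorem orbit_eq (Y : LieAmbient) (t : ℝ) : orbit Y t = flow Y t *ᵥ origin := by
  rw [orbit, act, flow, Matrix.smul_mulVec]

theorem infAct_eq (Y : LieAmbient) (v : V) : infAct Y v = generator Y *ᵥ v := by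
  rw [infAct, generator, Matrix.sub_mulVec, Matrix.smul_mulVec, Matrix.one_mulVec]

theorem flow_mul_flow_neg (Y : LieAmbient) (t : ℝ) : flow Y t * flow Y (-t) = 1 := by
  have hu : IsUnit (NormedSpace.exp (t • Y.1)) := Matrix.isUnit_exp _
  rw [flow, flow, Matrix.smul_mul, Matrix.mul_smul, smul_smul, neg_smul, Matrix.exp_neg,
    Matrix.mul_nonsing_inv _ ((Matrix.isUnit_iff_isUnit_det _).1 hu)]
  rw [← Complex.exp_neg, ← Complex.exp_neg, ← Complex.exp_add]
  simp

theorem flow_neg_mul_flow (Y : LieAmbient) (t : ℝ) : flow Y (-t) * flow Y t = 1 := by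
  simpa using flow_mul_flow_neg Y (-t)

theorem exp_mem_G {Y : LieAmbient} (hY : IsInLieAlgebra Y) (t : ℝ) :
    (NormedSpace.exp (t • Y.1), Complex.exp (t * (Complex.I * Y.2))) ∈ G := by
  have hu : IsUnit (NormedSpace.exp (t • Y.1)) := Matrix.isUnit_exp _
  have hu' := (Matrix.isUnit_iff_isUnit_det _).1 hu
  refine ⟨(Matrix.mem_unitaryGroup_iff').2 ?_, ?_, ?_⟩
  · rw [Matrix.star_eq_conjTranspose, ← Matrix.exp_conjTranspose, Matrix.conjTranspose_smul, hY.1,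
      star_trivial, smul_neg, Matrix.exp_neg, Matrix.nonsing_inv_mul _ hu']
  · have hJJ : J * -J = 1 := by
      ext i j
      fin_cases i <;> fin_cases j <;> simp [J, Matrix.mul_apply, Fin.sum_univ_four]
    have hJu : IsUnit J := IsUnit.of_mul_eq_one _ hJJ
    have hJi : J⁻¹ = -J := Matrix.inv_eq_right_inv hJJ
    have hT : (t • Y.1)ᵀ = J * (-(t • Y.1)) * J⁻¹ := by
      have : Y.1ᵀ * (J * J⁻¹) = -(J * Y.1) * J⁻¹ := by rw [← Matrix.mul_assoc, hY.2]
      rw [hJi, hJJ, Matrix.mul_one] at this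
      rw [Matrix.transpose_smul, this, hJi]
      simp
    rw [← Matrix.exp_transpose, hT, Matrix.exp_conj _ _ hJu, Matrix.exp_neg,
      Matrix.mul_assoc (J * _), Matrix.nonsing_inv_mul _ ((Matrix.isUnit_iff_isUnit_det _).1 hJu),
      Matrix.mul_one, Matrix.mul_assoc, Matrix.nonsing_inv_mul _ hu', Matrix.mul_one]
  · rw [show (t * (Complex.I * Y.2) : ℂ) = ((t * Y.2 : ℝ) : ℂ) * Complex.I by push_cast; ring,
      Complex.norm_exp_ofReal_mul_I]

theorem act_exp (Y : LieAmbient) (t : ℝ) (v : V) :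
    act (NormedSpace.exp (t • Y.1), Complex.exp (t * (Complex.I * Y.2))) v = flow Y t *ᵥ v := by
  rw [act, flow, Matrix.smul_mulVec]

theorem herm_flow {Y : LieAmbient} (hY : IsInLieAlgebra Y) (t : ℝ) (q v : V) :
    herm (flow Y t *ᵥ q) (flow Y t *ᵥ v) = herm q v := by
  rw [← act_exp, ← act_exp, herm_act (exp_mem_G hY t)]

theorem invariant_flow {Y : LieAmbient} (hY : IsInLieAlgebra Y) (t : ℝ) (q v : V) :
    invariant (flow Y t *ᵥ q) (flow Y t *ᵥ v) = invariant q v := by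
  rw [← act_exp, ← act_exp, invariant_act (exp_mem_G hY t)]

open scoped Matrix.Norms.Operator in
theorem hasDerivAt_flow (Y : LieAmbient) (t : ℝ) (i j : Fin 4) :
    HasDerivAt (fun t => flow Y t i j) ((flow Y t * generator Y) i j) t := by
  have h1 : HasDerivAt (fun s : ℝ => NormedSpace.exp (s • Y.1) i j)
      ((NormedSpace.exp (t • Y.1) * Y.1) i j) t :=
    hasDerivAt_pi.1 (hasDerivAt_pi.1 (hasDerivAt_exp_smul_const (𝕂 := ℝ) Y.1 t) i) j
  have h2 : HasDerivAt (fun s : ℝ => Complex.exp (-(s * (Complex.I * Y.2))))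
      (Complex.exp (-(t * (Complex.I * Y.2))) * -(1 * (Complex.I * Y.2))) t :=
    (((Complex.ofRealCLM.hasDerivAt (x := t)).mul_const _).neg).cexp
  refine ((h2.mul h1).congr_deriv ?_).congr_of_eventuallyEq
    (Filter.Eventually.of_forall fun s => ?_)
  · simp only [flow, generator, Matrix.mul_sub, Matrix.mul_smul, Matrix.mul_one, Matrix.sub_apply,
      Matrix.smul_apply, Matrix.smul_mul, smul_eq_mul, ← Complex.exp_neg]
    ring
  · simp [flow, ← Complex.exp_neg]

open scoped Matrix.Norms.Operator in
theorem contDiff_flow (Y : LieAmbient) (i j : Fin 4) : ContDiff ℝ ∞ (fun t => flow Y t i j) := by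
  have h0 : ContDiff ℝ ∞ (NormedSpace.exp : Matrix (Fin 4) (Fin 4) ℂ → _) :=
    contDiff_iff_contDiffAt.2 fun x => (NormedSpace.exp_analytic (𝕂 := ℝ) x).contDiffAt
  have h1 : ContDiff ℝ ∞ (fun t : ℝ => NormedSpace.exp (t • Y.1) i j) :=
    (LinearMap.toContinuousLinearMap (Matrix.entryLinearMap ℝ ℂ i j)).contDiff.comp
      (h0.comp (by fun_prop : ContDiff ℝ ∞ fun t : ℝ => t • Y.1))
  have h2 : ContDiff ℝ ∞ (fun s : ℝ => Complex.exp (-(s * (Complex.I * Y.2)))) :=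
    ((Complex.ofRealCLM.contDiff.mul contDiff_const).neg).cexp
  have h3 : (fun t => flow Y t i j) = fun s : ℝ =>
      Complex.exp (-(s * (Complex.I * Y.2))) * NormedSpace.exp (s • Y.1) i j := by
    ext s
    simp [flow, ← Complex.exp_neg]
  rw [h3]
  exact h2.mul h1

theorem contDiff_flow_mulVec (Y : LieAmbient) {E : Type*} [NormedAddCommGroup E] [NormedSpace ℝ E]
    {τ : E → ℝ} {v : E → V} (hτ : ContDiff ℝ ∞ τ) (hv : ContDiff ℝ ∞ v) :
    ContDiff ℝ ∞ (fun p => flow Y (τ p) *ᵥ v p) := by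
  refine contDiff_pi.2 fun i => ?_
  simp only [Matrix.mulVec, dotProduct]
  exact ContDiff.sum fun j _ => ((contDiff_flow Y i j).comp hτ).mul (contDiff_pi.1 hv j)

theorem hasDerivAt_flow_mulVec (Y : LieAmbient) {v : ℝ → V} {v' : V} {t : ℝ}
    (hv : HasDerivAt v v' t) :
    HasDerivAt (fun t => flow Y t *ᵥ v t) (flow Y t *ᵥ (v' + infAct Y (v t))) t := by
  refine hasDerivAt_pi.2 fun i => ?_
  have h := HasDerivAt.fun_sum (u := Finset.univ) fun j _ =>
    (hasDerivAt_flow Y t i j).mul (hasDerivAt_pi.1 hv j)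
  refine h.congr_deriv ?_
  rw [infAct_eq, Matrix.mulVec_add, Matrix.mulVec_mulVec, add_comm, Finset.sum_add_distrib]
  rfl

/-! ### The first variation of the energy -/

theorem contDiff_invariant : ContDiff ℝ ∞ fun p : V × V => invariant p.1 p.2 := by
  have hre : ContDiff ℝ ∞ Complex.re := Complex.reCLM.contDiff
  have hn : ContDiff ℝ ∞ Complex.normSq := by
    have : (Complex.normSq : ℂ → ℝ) = fun z => z.re * z.re + z.im * z.im := by
      ext z; exact Complex.normSq_apply z
    rw [this]
    exact (hre.mul hre).add (Complex.imCLM.contDiff.mul Complex.imCLM.contDiff)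
  have hs : ContDiff ℝ ∞ (star : ℂ → ℂ) := Complex.conjCLE.contDiff
  have hc : ∀ i, ContDiff ℝ ∞ fun v : V => v i := fun i => contDiff_apply ℝ ℂ i
  have hh : ContDiff ℝ ∞ fun p : V × V => herm p.1 p.2 := by
    simp only [herm, dotProduct, Pi.star_apply]
    exact ContDiff.sum fun i _ => (hs.comp ((hc i).comp contDiff_fst)).mul
      ((hc i).comp contDiff_snd)
  have hσ : ContDiff ℝ ∞ fun p : V × V => sympl p.1 p.2 := by
    simp only [sympl_eq]
    have h1 : ∀ i, ContDiff ℝ ∞ fun p : V × V => p.1 i := fun i => (hc i).comp contDiff_fst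
    have h2 : ∀ i, ContDiff ℝ ∞ fun p : V × V => p.2 i := fun i => (hc i).comp contDiff_snd
    exact ((((h1 1).mul (h2 0)).sub ((h1 0).mul (h2 1))).add ((h1 3).mul (h2 2))).sub
      ((h1 2).mul (h2 3))
  have hv : ContDiff ℝ ∞ fun p : V × V => herm p.2 p.2 :=
    hh.comp (contDiff_snd.prodMk contDiff_snd)
  refine contDiff_pi.2 fun i => ?_
  fin_cases i
  · exact ((hre.comp hv).sub (hn.comp hh)).sub (hn.comp hσ)
  · exact hn.comp hh
  · exact hn.comp hσ

theorem isLinearMap_infAct (Y : LieAmbient) : IsLinearMap ℝ (infAct Y) where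
  map_add v w := by simp only [infAct_eq, Matrix.mulVec_add]
  map_smul r v := by simp only [infAct_eq, Matrix.mulVec_smul]

/-- `infAct Y` as a continuous linear map. -/
def infActCLM (Y : LieAmbient) : V →L[ℝ] V :=
  LinearMap.toContinuousLinearMap (isLinearMap_infAct Y).mk'

@[simp] theorem infActCLM_apply (Y : LieAmbient) (v : V) : infActCLM Y v = infAct Y v := rfl

/-- The function `(q, v) ↦ φ (invariant q v)` on pairs of vectors. -/
def energyDensity (φ : (Fin 3 → ℝ) → ℝ) (p : V × V) : ℝ := φ (invariant p.1 p.2)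

/-- The linear form whose vanishing on the tangent space at the origin characterises the geodesic
vectors. -/
def eulerForm (φ : (Fin 3 → ℝ) → ℝ) (Y : LieAmbient) (w : V) : ℝ :=
  fderiv ℝ (energyDensity φ) (origin, infAct Y origin) (w, infAct Y w)

theorem contDiffOn_energyDensity {φ : (Fin 3 → ℝ) → ℝ} {U : Set (Fin 3 → ℝ)}
    (hφ : ContDiffOn ℝ 1 φ U) :
    ContDiffOn ℝ 1 (energyDensity φ) {p | invariant p.1 p.2 ∈ U} :=
  hφ.comp (contDiff_invariant.of_le (by exact WithTop.coe_le_coe.2 le_top)).contDiffOn fun _ hp => hp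

/-- The flow preserves `invariant`, so it drops out of the density. At `s = 0` the argument of the
density is the fixed point `(o, Yo)`, so the differential there is constant in `t` and only its part
`eulerForm` survives integration by parts. -/
theorem hasDerivAt_energy {φ : (Fin 3 → ℝ) → ℝ} {U : Set (Fin 3 → ℝ)} (hU : IsOpen U)
    (hφ : ContDiffOn ℝ 1 φ U) {Y : LieAmbient} (hY : IsInLieAlgebra Y)
    (hYU : invariant origin (infAct Y origin) ∈ U) {a b : ℝ} (hab : a ≤ b) {u : ℝ × ℝ → V}
    (hu : ContDiff ℝ ∞ u) (hu0 : ∀ t, u (0, t) = origin) (hua : ∀ s, u (s, a) = origin)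
    (hub : ∀ s, u (s, b) = origin) :
    HasDerivAt (fun s => ∫ t in a..b, energyDensity φ
        (flow Y t *ᵥ u (s, t), deriv (fun t => flow Y t *ᵥ u (s, t)) t))
      (∫ t in a..b, eulerForm φ Y (fderiv ℝ u (0, t) (1, 0))) 0 := by
  have hud : ∀ p, HasFDerivAt u (fderiv ℝ u p) p := fun p =>
    (hu.differentiable (by simp) p).hasFDerivAt
  have hu' : ContDiff ℝ ∞ (fderiv ℝ u) := hu.fderiv_right (by simp)
  have hs : ∀ s t, HasDerivAt (fun s => u (s, t)) (fderiv ℝ u (s, t) (1, 0)) s := fun s t =>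
    (hud (s, t)).comp_hasDerivAt s ((hasDerivAt_id s).prodMk (hasDerivAt_const s t))
  have ht : ∀ s t, HasDerivAt (fun t => u (s, t)) (fderiv ℝ u (s, t) (0, 1)) t := fun s t =>
    (hud (s, t)).comp_hasDerivAt t ((hasDerivAt_const t s).prodMk (hasDerivAt_id t))
  set W : ℝ × ℝ → V × V := fun p => (u p, fderiv ℝ u p (0, 1) + infActCLM Y (u p)) with hW
  have hWd : ContDiff ℝ ∞ W := by
    refine hu.prodMk (((hu'.clm_apply contDiff_const)).add ?_)
    exact (infActCLM Y).contDiff.comp hu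
  have hW0 : ∀ t, W (0, t) = (origin, infAct Y origin) := by
    intro t
    have h := (ht 0 t).unique ((hasDerivAt_const t origin).congr_of_eventuallyEq
      (Filter.Eventually.of_forall hu0))
    simp [hW, hu0, h]
  have hdens : ∀ s t, energyDensity φ
      (flow Y t *ᵥ u (s, t), deriv (fun t => flow Y t *ᵥ u (s, t)) t) = energyDensity φ (W (s, t)) := by
    intro s t
    rw [(hasDerivAt_flow_mulVec Y (ht s t)).deriv]
    simp only [energyDensity, invariant_flow hY, hW, infActCLM_apply]
  have hUo : IsOpen {p : V × V | invariant p.1 p.2 ∈ U} :=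
    hU.preimage contDiff_invariant.continuous
  have hE := contDiffOn_energyDensity hφ
  have hmem : (origin, infAct Y origin) ∈ {p : V × V | invariant p.1 p.2 ∈ U} := hYU
  have hEd : HasFDerivAt (energyDensity φ)
      (fderiv ℝ (energyDensity φ) (origin, infAct Y origin)) (origin, infAct Y origin) :=
    ((hE.contDiffAt (hUo.mem_nhds hmem)).differentiableAt one_ne_zero).hasFDerivAt
  have hmain := hasDerivAt_intervalIntegral_of_contDiffOn (f := fun p => energyDensity φ (W p))
    (hUo.preimage hWd.continuous)
    (hE.comp (hWd.of_le (by exact WithTop.coe_le_coe.2 le_top)).contDiffOn fun _ hp => hp) hab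
    (fun t _ => by simpa [hW0] using hYU)
  simp only [hdens]
  refine hmain.congr_deriv ?_
  set D := fderiv ℝ (energyDensity φ) (origin, infAct Y origin) with hD
  have hu'd : ∀ p, HasFDerivAt (fderiv ℝ u) (fderiv ℝ (fderiv ℝ u) p) p := fun p =>
    (hu'.differentiable (by simp) p).hasFDerivAt
  -- Exchanging `∂ₛ` and `∂ₜ` identifies the variation of the velocity `∂ₜu` with the `t`-derivative
  -- of the variation field.
  have hsymm : ∀ p, fderiv ℝ (fderiv ℝ u) p (1, 0) (0, 1) = fderiv ℝ (fderiv ℝ u) p (0, 1) (1, 0) :=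
    fun p => (hu.contDiffAt.isSymmSndFDerivAt (by
      rw [minSmoothness_of_isRCLikeNormedField]; exact WithTop.coe_le_coe.2 le_top)) (1, 0) (0, 1)
  have hw' : ∀ t, HasDerivAt (fun t => fderiv ℝ u (0, t) (1, 0))
      (fderiv ℝ (fderiv ℝ u) (0, t) (0, 1) (1, 0)) t := by
    intro t
    have h := (hu'd (0, t)).comp_hasDerivAt t ((hasDerivAt_const t (0 : ℝ)).prodMk (hasDerivAt_id t))
    simpa using h.clm_apply (hasDerivAt_const t ((1 : ℝ), (0 : ℝ)))
  have hpt : ∀ t, fderiv ℝ (fun p => energyDensity φ (W p)) (0, t) (1, 0) =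
      eulerForm φ Y (fderiv ℝ u (0, t) (1, 0)) +
        D (0, fderiv ℝ (fderiv ℝ u) (0, t) (0, 1) (1, 0)) := by
    intro t
    have h1 : HasDerivAt (fun s => fderiv ℝ u (s, t) (0, 1))
        (fderiv ℝ (fderiv ℝ u) (0, t) (0, 1) (1, 0)) 0 := by
      have h := (hu'd (0, t)).comp_hasDerivAt (0 : ℝ)
        ((hasDerivAt_id (0 : ℝ)).prodMk (hasDerivAt_const (0 : ℝ) t))
      rw [← hsymm]
      simpa using h.clm_apply (hasDerivAt_const (0 : ℝ) ((0 : ℝ), (1 : ℝ)))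
    have h2 : HasDerivAt (fun s => W (s, t)) (fderiv ℝ u (0, t) (1, 0),
        fderiv ℝ (fderiv ℝ u) (0, t) (0, 1) (1, 0) + infActCLM Y (fderiv ℝ u (0, t) (1, 0))) 0 :=
      (hs 0 t).prodMk (h1.add ((infActCLM Y).hasFDerivAt.comp_hasDerivAt (0 : ℝ) (hs 0 t)))
    have hEd' : HasFDerivAt (energyDensity φ) D (W (0, t)) := by rw [hW0]; exact hEd
    have h3 := hEd'.comp_hasDerivAt (0 : ℝ) h2
    have hWf : DifferentiableAt ℝ W (0, t) := hWd.differentiable (by simp) _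
    have h4 : HasFDerivAt (fun p => energyDensity φ (W p))
        (fderiv ℝ (fun p => energyDensity φ (W p)) (0, t)) (0, t) :=
      (hEd'.differentiableAt.comp (0, t) hWf).hasFDerivAt
    have h5 := h4.comp_hasDerivAt (0 : ℝ)
      ((hasDerivAt_id (0 : ℝ)).prodMk (hasDerivAt_const (0 : ℝ) t))
    rw [h5.unique h3, eulerForm, ← hD, ← map_add]
    simp [add_comm]
  simp only [hpt]
  have hcw : Continuous fun t : ℝ => fderiv ℝ u (0, t) (1, 0) :=
    continuous_iff_continuousAt.2 fun t => (hw' t).continuousAt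
  have hc1 : Continuous fun t : ℝ => eulerForm φ Y (fderiv ℝ u (0, t) (1, 0)) := by
    have : Continuous (infAct Y) := (infActCLM Y).continuous
    unfold eulerForm
    fun_prop
  have hc2' : Continuous fun t : ℝ => fderiv ℝ (fderiv ℝ u) (0, t) (0, 1) (1, 0) := by
    have : Continuous (fderiv ℝ (fderiv ℝ u)) := (hu'.fderiv_right (m := ∞) (by simp)).continuous
    fun_prop
  have hc2 : Continuous fun t : ℝ => D (0, fderiv ℝ (fderiv ℝ u) (0, t) (0, 1) (1, 0)) := by
    fun_prop
  -- The second summand is the derivative of `t ↦ D(0, w(t))`, where `w` is the variation field; it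
  -- leaves boundary values, which vanish because the end points are fixed.
  rw [intervalIntegral.integral_add (hc1.intervalIntegrable _ _) (hc2.intervalIntegrable _ _),
    intervalIntegral.integral_eq_sub_of_hasDerivAt
      (f := fun t => D (0, fderiv ℝ u (0, t) (1, 0)))
      (fun t _ => D.hasFDerivAt.comp_hasDerivAt t ((hasDerivAt_const t (0 : V)).prodMk (hw' t)))
      (hc2.intervalIntegrable _ _)]
  have hz : ∀ t, (∀ s, u (s, t) = origin) → fderiv ℝ u (0, t) (1, 0) = 0 := fun t h =>
    (hs 0 t).unique ((hasDerivAt_const (0 : ℝ) origin).congr_of_eventuallyEq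
      (Filter.Eventually.of_forall h))
  simp [hz a hua, hz b hub]

/-! ### Geodesic vectors -/

/-- The square of `F` is the function `φ` of `α₁, α₂, α₃`, which is `C¹` on the neighbourhood `U` of
the values at nonzero vectors. -/
structure HasProfile (F : M → ℝ) (φ : (Fin 3 → ℝ) → ℝ) (U : Set (Fin 3 → ℝ)) : Prop where
  isOpen : IsOpen U
  contDiffOn : ContDiffOn ℝ 1 φ U
  sq_eq : ∀ y, F y ^ 2 = φ (fun i => alpha i y)
  alpha_mem : ∀ y, y ≠ 0 → (fun i => alpha i y) ∈ U

theorem hasDerivAt_herm {q v : ℝ → V} {q' v' : V} {t : ℝ} (hq : HasDerivAt q q' t)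
    (hv : HasDerivAt v v' t) :
    HasDerivAt (fun t => herm (q t) (v t)) (herm q' (v t) + herm (q t) v') t := by
  have h := HasDerivAt.fun_sum (u := Finset.univ) fun i _ =>
    ((hasDerivAt_pi.1 hq i).star).fun_mul (hasDerivAt_pi.1 hv i)
  rw [Finset.sum_add_distrib] at h
  exact h

theorem hasDerivAt_slice {u : ℝ × ℝ → V} (hu : ContDiff ℝ ∞ u) (s t : ℝ) :
    HasDerivAt (fun s => u (s, t)) (fderiv ℝ u (s, t) (1, 0)) s := by
  have h : HasFDerivAt u (fderiv ℝ u (s, t)) (s, t) :=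
    (hu.differentiable (by simp) (s, t)).hasFDerivAt
  exact h.comp_hasDerivAt s ((hasDerivAt_id s).prodMk (hasDerivAt_const s t))

theorem herm_deriv_re_eq_zero {γ : ℝ → V} {γ' : V} {t : ℝ} (hγ : HasDerivAt γ γ' t)
    (hs : ∀ t, γ t ∈ sphere) : (herm (γ t) γ').re = 0 := by
  have h := hasDerivAt_herm hγ hγ
  have h' := h.unique ((hasDerivAt_const t (1 : ℂ)).congr_of_eventuallyEq
    (Filter.Eventually.of_forall fun t => (mem_sphere_iff _).1 (hs t)))
  have h'' := congrArg Complex.re h'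
  simp [herm_eq] at h''
  simp [herm_eq]
  linarith

theorem flow_mulVec_mem_sphere {Y : LieAmbient} (hY : IsInLieAlgebra Y) (t : ℝ) {v : V}
    (hv : v ∈ sphere) : flow Y t *ᵥ v ∈ sphere := by
  rw [mem_sphere_iff] at *
  rw [herm_flow hY, hv]

theorem eulerForm_smul (φ : (Fin 3 → ℝ) → ℝ) (Y : LieAmbient) (r : ℝ) (w : V) :
    eulerForm φ Y (r • w) = r * eulerForm φ Y w := by
  rw [eulerForm, (isLinearMap_infAct Y).map_smul, ← Prod.smul_mk, map_smul, smul_eq_mul, eulerForm]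

/-- The energy of a family of curves in the sphere, in terms of the energy density. -/
theorem integral_homogeneousMetric_sq {F : M → ℝ} {φ : (Fin 3 → ℝ) → ℝ} {U : Set (Fin 3 → ℝ)}
    (hF : HasProfile F φ U) {c : ℝ → ℝ → V} (hc : ContDiff ℝ ∞ (Function.uncurry c))
    (hcs : ∀ s t, c s t ∈ sphere) (a b s : ℝ) :
    ∫ t in a..b, homogeneousMetric F (c s t) (deriv (c s) t) ^ 2 =
      ∫ t in a..b, energyDensity φ (c s t, deriv (c s) t) := by
  refine intervalIntegral.integral_congr fun t _ => ?_
  have hd : ContDiff ℝ ∞ (c s) := hc.comp (contDiff_const.prodMk contDiff_id)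
  exact homogeneousMetric_sq hF.sq_eq (hcs s t)
    (herm_deriv_re_eq_zero (hd.differentiable (by simp) t).hasDerivAt (hcs s))

theorem contDiff_orbit (Y : LieAmbient) : ContDiff ℝ ∞ (orbit Y) := by
  have : orbit Y = fun t => flow Y t *ᵥ origin := funext (orbit_eq Y)
  rw [this]
  exact contDiff_flow_mulVec Y contDiff_id contDiff_const

theorem orbit_mem_sphere {Y : LieAmbient} (hY : IsInLieAlgebra Y) (t : ℝ) : orbit Y t ∈ sphere := by
  rw [orbit_eq]
  exact flow_mulVec_mem_sphere hY t origin_mem_sphere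

theorem isGeodesicVector_of_eulerForm {F : M → ℝ} {φ : (Fin 3 → ℝ) → ℝ} {U : Set (Fin 3 → ℝ)}
    (hF : HasProfile F φ U) {Y : LieAmbient} (hY : IsInLieAlgebra Y)
    (hYU : invariant origin (infAct Y origin) ∈ U)
    (h : ∀ w : V, (w 2).re = 0 → eulerForm φ Y w = 0) : IsGeodesicVector F Y := by
  refine ⟨contDiff_orbit Y, orbit_mem_sphere hY, fun a b hab c hc hcs hc0 hca hcb => ?_⟩
  simp only [integral_homogeneousMetric_sq hF hc hcs]
  -- Pulling back by the flow makes the unvaried curve constant, so every variation field takes its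
  -- values in the single space `T_o S⁷`, where `h` applies.
  set u : ℝ × ℝ → V := fun p => flow Y (-p.2) *ᵥ c p.1 p.2 with hu
  have hud : ContDiff ℝ ∞ u := contDiff_flow_mulVec Y contDiff_snd.neg hc
  have hcu : ∀ s t, c s t = flow Y t *ᵥ u (s, t) := fun s t => by
    rw [hu, Matrix.mulVec_mulVec, flow_mul_flow_neg, Matrix.one_mulVec]
  have huo : ∀ s t, c s t = orbit Y t → u (s, t) = origin := fun s t hst => by
    simp only [hu]
    rw [hst, orbit_eq, Matrix.mulVec_mulVec, flow_neg_mul_flow, Matrix.one_mulVec]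
  have hmain := hasDerivAt_energy hF.isOpen hF.contDiffOn hY hYU hab.le hud
    (fun t => huo 0 t (hc0 t)) (fun s => huo s a (hca s)) (fun s => huo s b (hcb s))
  have hcu' : ∀ s, c s = fun t => flow Y t *ᵥ u (s, t) := fun s => funext (hcu s)
  simp only [hcu']
  refine hmain.congr_deriv ?_
  rw [intervalIntegral.integral_congr (g := fun _ => 0), intervalIntegral.integral_zero]
  intro t _
  refine h _ ?_
  have hs := hasDerivAt_slice hud 0 t
  have h0 := herm_deriv_re_eq_zero hs fun s => flow_mulVec_mem_sphere hY (-t) (hcs s t)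
  rw [huo 0 t (hc0 t)] at h0
  simpa [herm_eq, origin_eq] using h0

theorem cos_smul_add_sin_smul_mem_sphere {w : V} (hw : (w 2).re = 0) (hw1 : herm w w = 1) (θ : ℝ) :
    Real.cos θ • origin + Real.sin θ • w ∈ sphere := by
  rw [mem_sphere_iff]
  have hc : ((Real.cos θ : ℝ) : ℂ) ^ 2 + ((Real.sin θ : ℝ) : ℂ) ^ 2 = 1 := by
    exact_mod_cast Real.cos_sq_add_sin_sq θ
  have hw' : w 2 + (starRingEnd ℂ) (w 2) = 0 := by
    rw [Complex.add_conj, hw]; simp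
  rw [herm_eq] at *
  simp only [Complex.star_def] at hw1
  simp only [origin_eq, Pi.add_apply, Pi.smul_apply, Complex.real_smul, Complex.star_def, map_add,
    map_mul, Complex.conj_ofReal]
  generalize ((Real.cos θ : ℝ) : ℂ) = C at *
  generalize ((Real.sin θ : ℝ) : ℂ) = S at *
  simp
  linear_combination S ^ 2 * hw1 + hc + C * S * hw'

/-- One test variation suffices: the origin is moved along the great circle towards `w` by the angle
`s t (1 - t)`. The variation field is `t (1 - t) w`, so the first variation on `[0, 1]` is
`eulerForm φ Y w / 6`. -/
theorem eulerForm_eq_zero_of_isGeodesicVector {F : M → ℝ} {φ : (Fin 3 → ℝ) → ℝ}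
    {U : Set (Fin 3 → ℝ)} (hF : HasProfile F φ U) {Y : LieAmbient} (hY : IsInLieAlgebra Y)
    (hYU : invariant origin (infAct Y origin) ∈ U) (h : IsGeodesicVector F Y) {w : V}
    (hw : (w 2).re = 0) (hw1 : herm w w = 1) : eulerForm φ Y w = 0 := by
  set β : ℝ → ℝ := fun t => t * (1 - t) with hβ
  set u : ℝ × ℝ → V := fun p => Real.cos (p.1 * β p.2) • origin + Real.sin (p.1 * β p.2) • w with hu
  have hθ : ContDiff ℝ ∞ fun p : ℝ × ℝ => p.1 * β p.2 := by
    simp only [hβ]; fun_prop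
  have hud : ContDiff ℝ ∞ u := (hθ.cos.smul contDiff_const).add (hθ.sin.smul contDiff_const)
  have hu0 : ∀ t, u (0, t) = origin := fun t => by simp [hu]
  have hua : ∀ s, u (s, 0) = origin := fun t => by simp [hu, hβ]
  have hub : ∀ s, u (s, 1) = origin := fun t => by simp [hu, hβ]
  have hc : ContDiff ℝ ∞ (Function.uncurry fun s t => flow Y t *ᵥ u (s, t)) :=
    contDiff_flow_mulVec Y contDiff_snd hud
  have hcs : ∀ s t, flow Y t *ᵥ u (s, t) ∈ sphere := fun s t =>
    flow_mulVec_mem_sphere hY t (cos_smul_add_sin_smul_mem_sphere hw hw1 _)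
  have h1 := h.2.2 0 1 one_pos (fun s t => flow Y t *ᵥ u (s, t)) hc hcs
    (fun t => by rw [hu0, orbit_eq]) (fun s => by rw [hua, orbit_eq])
    (fun s => by rw [hub, orbit_eq])
  simp only [integral_homogeneousMetric_sq hF hc hcs] at h1
  have h2 := h1.unique (hasDerivAt_energy hF.isOpen hF.contDiffOn hY hYU zero_le_one hud hu0 hua hub)
  have hd : ∀ t, fderiv ℝ u (0, t) (1, 0) = β t • w := by
    intro t
    have hs := hasDerivAt_slice hud 0 t
    have hl : HasDerivAt (fun s : ℝ => s * β t) (1 * β t) 0 := (hasDerivAt_id (0 : ℝ)).mul_const _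
    have hs' := (hl.cos.smul_const origin).add (hl.sin.smul_const w)
    rw [hs.unique hs']
    simp
  simp only [hd, eulerForm_smul, intervalIntegral.integral_mul_const] at h2
  have h3 : ∫ t in (0 : ℝ)..1, β t = 1 / 6 := by
    have : β = fun t => t - t ^ 2 := by ext t; simp only [hβ]; ring
    rw [this, intervalIntegral.integral_sub (by simp) (by simp), integral_id, integral_pow]
    norm_num
  rw [h3] at h2
  linarith

/-! ### The Euler form in coordinates -/

theorem isInLieAlgebra_mVec_add_hVec (y : M) (ζ : Fin 4 → ℝ) :
    IsInLieAlgebra (mVec y + hVec ζ) := by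
  constructor
  · ext i j
    fin_cases i <;> fin_cases j <;> simp [mVec, hVec, spMatrix] <;> ring
  · ext i j
    fin_cases i <;> fin_cases j <;>
      simp [mVec, hVec, spMatrix, J, Matrix.mul_apply, Fin.sum_univ_four] <;> ring

theorem hasDerivAt_normSq {f : ℝ → ℂ} {f' : ℂ} {t : ℝ} (hf : HasDerivAt f f' t) :
    HasDerivAt (fun t => Complex.normSq (f t)) (2 * (star (f t) * f').re) t := by
  have h1 : HasDerivAt (fun t => (f t).re) f'.re t :=
    Complex.reCLM.hasFDerivAt.comp_hasDerivAt t hf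
  have h2 : HasDerivAt (fun t => (f t).im) f'.im t :=
    Complex.imCLM.hasFDerivAt.comp_hasDerivAt t hf
  refine (((h1.mul h1).add (h2.mul h2)).congr_deriv ?_).congr_of_eventuallyEq
    (Filter.Eventually.of_forall fun s => Complex.normSq_apply _)
  simp
  ring

theorem hasDerivAt_sympl {q v : ℝ → V} {q' v' : V} {t : ℝ} (hq : HasDerivAt q q' t)
    (hv : HasDerivAt v v' t) :
    HasDerivAt (fun t => sympl (q t) (v t)) (sympl q' (v t) + sympl (q t) v') t := by
  simp only [sympl_eq]
  have h1 := hasDerivAt_pi.1 hq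
  have h2 := hasDerivAt_pi.1 hv
  exact (((((h1 1).mul (h2 0)).sub ((h1 0).mul (h2 1))).add ((h1 3).mul (h2 2))).sub
    ((h1 2).mul (h2 3))).congr_deriv (by ring)

/-- Chain rule along the line `s ↦ (o + s w, Yo + s Yw)`. The differences `C 1 - C 0` and `C 2 - C
0` appear because the first invariant is `|v|²` minus the other two. -/
theorem eulerForm_eq_sum {F : M → ℝ} {φ : (Fin 3 → ℝ) → ℝ} {U : Set (Fin 3 → ℝ)}
    (hF : HasProfile F φ U) (Y : LieAmbient) (hYU : invariant origin (infAct Y origin) ∈ U) (w : V)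
    {C : Fin 3 → ℝ}
    (hC : ∀ i, fderiv ℝ φ (invariant origin (infAct Y origin)) (Pi.single i 1) = C i) :
    eulerForm φ Y w =
      C 0 * (2 * (herm (infAct Y origin) (infAct Y w)).re) +
      (C 1 - C 0) * (2 * (star (herm origin (infAct Y origin)) *
        (herm w (infAct Y origin) + herm origin (infAct Y w))).re) +
      (C 2 - C 0) * (2 * (star (sympl origin (infAct Y origin)) *
        (sympl w (infAct Y origin) + sympl origin (infAct Y w))).re) := by
  set q : ℝ → V := fun s => origin + s • w with hq
  set v : ℝ → V := fun s => infAct Y origin + s • infAct Y w with hv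
  have hqd : HasDerivAt q w 0 := by
    simpa [hq] using ((hasDerivAt_id (0 : ℝ)).smul_const w).const_add origin
  have hvd : HasDerivAt v (infAct Y w) 0 := by
    simpa [hv] using ((hasDerivAt_id (0 : ℝ)).smul_const (infAct Y w)).const_add (infAct Y origin)
  have hq0 : q 0 = origin := by simp [hq]
  have hv0 : v 0 = infAct Y origin := by simp [hv]
  have hφ : HasFDerivAt φ (fderiv ℝ φ (invariant (q 0) (v 0))) (invariant (q 0) (v 0)) := by
    rw [hq0, hv0]
    exact ((hF.contDiffOn.contDiffAt (hF.isOpen.mem_nhds hYU)).differentiableAt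
      one_ne_zero).hasFDerivAt
  have hinv : DifferentiableAt ℝ (fun p : V × V => invariant p.1 p.2) (q 0, v 0) :=
    contDiff_invariant.differentiable (by simp) _
  have hE : HasFDerivAt (energyDensity φ) (fderiv ℝ (energyDensity φ) (q 0, v 0)) (q 0, v 0) :=
    (hφ.differentiableAt.comp (q 0, v 0) hinv).hasFDerivAt
  have h1 := hE.comp_hasDerivAt (0 : ℝ) (hqd.prodMk hvd)
  have hh := hasDerivAt_herm hqd hvd
  have hσ := hasDerivAt_sympl hqd hvd
  have hvv : HasDerivAt (fun s => (herm (v s) (v s)).re)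
      (herm (infAct Y w) (v 0) + herm (v 0) (infAct Y w)).re 0 :=
    Complex.reCLM.hasFDerivAt.comp_hasDerivAt (0 : ℝ) (hasDerivAt_herm hvd hvd)
  have h2 : HasDerivAt (fun s => invariant (q s) (v s))
      ![(herm (infAct Y w) (v 0) + herm (v 0) (infAct Y w)).re -
          2 * (star (herm (q 0) (v 0)) * (herm w (v 0) + herm (q 0) (infAct Y w))).re -
          2 * (star (sympl (q 0) (v 0)) * (sympl w (v 0) + sympl (q 0) (infAct Y w))).re,
        2 * (star (herm (q 0) (v 0)) * (herm w (v 0) + herm (q 0) (infAct Y w))).re,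
        2 * (star (sympl (q 0) (v 0)) * (sympl w (v 0) + sympl (q 0) (infAct Y w))).re] 0 := by
    refine hasDerivAt_pi.2 fun i => ?_
    fin_cases i
    · exact (hvv.sub (hasDerivAt_normSq hh)).sub (hasDerivAt_normSq hσ)
    · exact hasDerivAt_normSq hh
    · exact hasDerivAt_normSq hσ
  have h3 := hφ.comp_hasDerivAt (0 : ℝ) h2
  have h4 := h1.unique h3
  have hsym : (herm (infAct Y w) (v 0)).re = (herm (v 0) (infAct Y w)).re := by
    simp [herm_eq]
    ring
  have hlin : ∀ d : Fin 3 → ℝ, fderiv ℝ φ (invariant origin (infAct Y origin)) d =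
      d 0 * C 0 + d 1 * C 1 + d 2 * C 2 := by
    intro d
    conv_lhs => rw [pi_eq_sum_univ' d]
    simp [Fin.sum_univ_three, ← hC]
  rw [hq0, hv0] at h4
  rw [eulerForm, h4, hlin]
  rw [hv0] at hsym
  simp only [Matrix.cons_val_zero, Matrix.cons_val_one, Matrix.cons_val, Complex.add_re, hsym]
  ring

/-- The coefficients of the Euler form of `y + ζ` on the tangent space at the origin. -/
def eulerCoeff (c : Fin 3 → ℝ) (y : M) (k : Fin 4 → ℝ) : Fin 6 → ℝ :=
  let x₁ := y.1 0
  let x₂ := y.1 1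
  let x₃ := y.1 2
  let x₄ := y.1 3
  let z₁ := y.2 0
  let z₂ := y.2 1
  let z₃ := y.2 2
  ![2 * c 0 * (x₂ * (k 0 - k 3) + x₃ * k 1 + x₄ * k 2 + z₁ * x₂ + z₂ * x₃ + z₃ * x₄)
      + 4 * (c 1 - c 0) * (z₁ * x₂) + 4 * (c 2 - c 0) * (z₂ * x₃ + z₃ * x₄),
    -2 * c 0 * (x₁ * (k 0 - k 3) + x₄ * k 1 - x₃ * k 2 + z₁ * x₁ + z₃ * x₃ - z₂ * x₄)
      - 4 * (c 1 - c 0) * (z₁ * x₁) - 4 * (c 2 - c 0) * (z₃ * x₃ - z₂ * x₄),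
    2 * c 0 * (-x₁ * k 1 - x₂ * k 2 + x₄ * (k 0 + k 3) - z₁ * x₄ - z₂ * x₁ + z₃ * x₂)
      - 4 * (c 1 - c 0) * (z₁ * x₄) - 4 * (c 2 - c 0) * (z₂ * x₁ - z₃ * x₂),
    -2 * c 0 * (x₂ * k 1 - x₁ * k 2 - x₃ * (k 0 + k 3) + z₁ * x₃ - z₃ * x₁ - z₂ * x₂)
      - 4 * (c 1 - c 0) * (z₁ * x₃) + 4 * (c 2 - c 0) * (z₃ * x₁ + z₂ * x₂),
    4 * z₃ * (c 2 * k 3 + (c 2 - c 1) * z₁),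
    4 * z₂ * (c 2 * k 3 + (c 2 - c 1) * z₁)]

theorem infAct_mVec_add_hVec_apply (y : M) (k : Fin 4 → ℝ) (w : V) :
    infAct (mVec y + hVec k) w =
      ![Complex.I * (k 0 - k 3) * w 0 + (-k 1 - Complex.I * k 2) * w 1 +
          (y.1 0 + Complex.I * y.1 1) * w 2 + (-y.1 2 - Complex.I * y.1 3) * w 3,
        (k 1 - Complex.I * k 2) * w 0 + -Complex.I * (k 0 + k 3) * w 1 +
          (y.1 2 - Complex.I * y.1 3) * w 2 + (y.1 0 - Complex.I * y.1 1) * w 3,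
        (-y.1 0 + Complex.I * y.1 1) * w 0 + (-y.1 2 - Complex.I * y.1 3) * w 1 +
          Complex.I * y.2 0 * w 2 + (-y.2 1 - Complex.I * y.2 2) * w 3,
        (y.1 2 - Complex.I * y.1 3) * w 0 + (-y.1 0 - Complex.I * y.1 1) * w 1 +
          (y.2 1 - Complex.I * y.2 2) * w 2 + -Complex.I * (y.2 0 + 2 * k 3) * w 3] := by
  ext i
  fin_cases i <;>
    simp [infAct, mVec, hVec, spMatrix, dotProduct, Fin.sum_univ_four] <;> ring

theorem eulerForm_eq {F : M → ℝ} {φ : (Fin 3 → ℝ) → ℝ} {U : Set (Fin 3 → ℝ)}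
    (hF : HasProfile F φ U) {y : M} (hy : y ≠ 0) (k : Fin 4 → ℝ) {w : V} (hw : (w 2).re = 0)
    {C : Fin 3 → ℝ} (hC : ∀ i, fderiv ℝ φ (fun i => alpha i y) (Pi.single i 1) = C i) :
    eulerForm φ (mVec y + hVec k) w =
      eulerCoeff C y k 0 * (w 0).re + eulerCoeff C y k 1 * (w 0).im +
      eulerCoeff C y k 2 * (w 1).re + eulerCoeff C y k 3 * (w 1).im +
      eulerCoeff C y k 4 * (w 3).re + eulerCoeff C y k 5 * (w 3).im := by
  have hinv : invariant origin (infAct (mVec y + hVec k) origin) = fun i => alpha i y := by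
    rw [infAct_mVec_add_hVec, invariant_origin]
  rw [eulerForm_eq_sum hF _ (by rw [hinv]; exact hF.alpha_mem y hy) w (by rwa [hinv]),
    infAct_mVec_add_hVec, infAct_mVec, infAct_mVec_add_hVec_apply, origin_eq]
  simp [herm_eq, sympl_eq, eulerCoeff, hw]
  ring

/-- The metric is felt only through the gradient `C` of `φ` at the point `α(y)`, so a Finsler metric
and a Riemannian one with the same `C` at `y` have the same geodesic vectors over `y`. For
necessity, six unit tangent vectors isolate the six coefficients. -/
theorem isGeodesicVector_iff {F : M → ℝ} {φ : (Fin 3 → ℝ) → ℝ} {U : Set (Fin 3 → ℝ)}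
    (hF : HasProfile F φ U) {y : M} (hy : y ≠ 0) (k : Fin 4 → ℝ)
    {C : Fin 3 → ℝ} (hC : ∀ i, fderiv ℝ φ (fun i => alpha i y) (Pi.single i 1) = C i) :
    IsGeodesicVector F (mVec y + hVec k) ↔ eulerCoeff C y k = 0 := by
  have hU : invariant origin (infAct (mVec y + hVec k) origin) ∈ U := by
    rw [infAct_mVec_add_hVec, invariant_origin]; exact hF.alpha_mem y hy
  have hY := isInLieAlgebra_mVec_add_hVec y k
  constructor
  · intro h
    have key : ∀ w : V, (w 2).re = 0 → herm w w = 1 → _ := fun w h1 h2 =>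
      (eulerForm_eq hF hy k h1 hC).symm.trans
        (eulerForm_eq_zero_of_isGeodesicVector hF hY hU h h1 h2)
    ext i
    fin_cases i
    · simpa using key ![1, 0, 0, 0] (by simp) (by simp [herm_eq])
    · simpa using key ![Complex.I, 0, 0, 0] (by simp) (by simp [herm_eq])
    · simpa using key ![0, 1, 0, 0] (by simp) (by simp [herm_eq])
    · simpa using key ![0, Complex.I, 0, 0] (by simp) (by simp [herm_eq])
    · simpa using key ![0, 0, 0, 1] (by simp) (by simp [herm_eq])
    · simpa using key ![0, 0, 0, Complex.I] (by simp) (by simp [herm_eq])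
  · intro h
    refine isGeodesicVector_of_eulerForm hF hY hU fun w hw => ?_
    rw [eulerForm_eq hF hy k hw hC, h]
    simp

/-! ### Solutions of the geodesic equations -/

theorem sum_sq_pos {x : Fin 4 → ℝ} (hx : x ≠ 0) :
    0 < x 0 ^ 2 + x 1 ^ 2 + x 2 ^ 2 + x 3 ^ 2 := by
  obtain ⟨i, hi⟩ := Function.ne_iff.1 hx
  have hi : x i ≠ 0 := hi
  have : 0 < x i ^ 2 := by positivity
  have h0 := sq_nonneg (x 0)
  have h1 := sq_nonneg (x 1)
  have h2 := sq_nonneg (x 2)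
  have h3 := sq_nonneg (x 3)
  fin_cases i <;> simp at this ⊢ <;> linarith

theorem eulerCoeff_explicitGraph {c : Fin 3 → ℝ} (hc : ∀ i, 0 < c i) (y : M) :
    eulerCoeff c y (explicitGraph c y) = 0 := by
  have h0 := (hc 0).ne'
  have h1 := (hc 1).ne'
  have h2 := (hc 2).ne'
  obtain ⟨x, z⟩ := y
  by_cases hx : x = 0
  · subst hx
    ext i
    fin_cases i <;> simp [eulerCoeff, explicitGraph, K₃] <;> right <;> field_simp <;> ring
  · have hN := (sum_sq_pos hx).ne'
    ext i
    fin_cases i <;> simp [eulerCoeff, explicitGraph, K₁, K₂, K₃] <;> (try right) <;>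
      field_simp <;> ring

theorem eq_K₃_of_eulerCoeff {c : Fin 3 → ℝ} (hc : ∀ i, 0 < c i) {y : M} {k : Fin 4 → ℝ}
    (h : eulerCoeff c y k = 0) (hz : y.2 1 ≠ 0 ∨ y.2 2 ≠ 0) : k 3 = K₃ c * y.2 0 := by
  have h2 := (hc 2).ne'
  have h4 := congrFun h 4
  have h5 := congrFun h 5
  simp [eulerCoeff] at h4 h5
  have h6 : c 2 * k 3 + (c 2 - c 1) * y.2 0 = 0 := by tauto
  rw [K₃]
  field_simp
  linarith

/-- Once the fourth components agree, the difference of the two solutions satisfies a homogeneous `4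
× 3` linear system. Up to the factor `2 c₁`, its columns are orthogonal, each of square norm `|x|²`,
so contracting with a column isolates one unknown. -/
theorem eq_of_eulerCoeff {c : Fin 3 → ℝ} (hc : ∀ i, 0 < c i) {y : M} {k l : Fin 4 → ℝ}
    (hk : eulerCoeff c y k = 0) (hl : eulerCoeff c y l = 0) (hx : y.1 ≠ 0) (h3 : k 3 = l 3) :
    k = l := by
  have hN := (sum_sq_pos hx).ne'
  have h0 := (hc 0).ne'
  have e : ∀ i, eulerCoeff c y k i - eulerCoeff c y l i = 0 := by simp [hk, hl]
  have e0 := e 0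
  have e1 := e 1
  have e2 := e 2
  have e3 := e 3
  simp only [eulerCoeff, Matrix.cons_val_zero, Matrix.cons_val_one, Matrix.cons_val, h3]
    at e0 e1 e2 e3
  have key : ∀ d : ℝ, 2 * c 0 * ((y.1 0 ^ 2 + y.1 1 ^ 2 + y.1 2 ^ 2 + y.1 3 ^ 2) * d) = 0 → d = 0 :=
    fun d hd => by simpa [h0, hN] using hd
  ext i
  refine sub_eq_zero.1 ?_
  fin_cases i
  · exact key _ (by
      simp only [Fin.zero_eta]
      linear_combination y.1 1 * e0 - y.1 0 * e1 + y.1 3 * e2 + y.1 2 * e3)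
  · exact key _ (by
      simp only [Fin.mk_one]
      linear_combination y.1 2 * e0 - y.1 3 * e1 - y.1 0 * e2 - y.1 1 * e3)
  · exact key _ (by
      simp only [Fin.reduceFinMk]
      linear_combination y.1 3 * e0 + y.1 2 * e1 - y.1 1 * e2 + y.1 0 * e3)
  · exact sub_eq_zero.2 h3

/-! ### Equivariance -/

/-- The projection of `ℂ⁴` to the third coordinate axis. -/
def proj₃ : Matrix (Fin 4) (Fin 4) ℂ := !![0, 0, 0, 0; 0, 0, 0, 0; 0, 0, 1, 0; 0, 0, 0, 0]

/-- The projection of `ℂ⁴` to the fourth coordinate axis. -/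
def proj₄ : Matrix (Fin 4) (Fin 4) ℂ := !![0, 0, 0, 0; 0, 0, 0, 0; 0, 0, 0, 0; 0, 0, 0, 1]

/-- Elements of the isotropy group preserve the last two coordinate axes. -/
theorem commute_proj_of_mem_H {σ : Matrix (Fin 4) (Fin 4) ℂ × ℂ} (hσ : σ ∈ H) :
    σ.1 * proj₃ = proj₃ * σ.1 ∧ σ.1 * proj₄ = proj₄ * σ.1 := by
  obtain ⟨⟨hU, hJ, hl⟩, ho⟩ := hσ
  obtain ⟨A, l⟩ := σ
  simp only at hU hJ hl
  have hl0 : l ≠ 0 := fun h => by simp [h] at hl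
  have hcol : ∀ i, A i 2 = l * origin i := by
    intro i
    have h := congrFun ho i
    simp only [act, Pi.smul_apply, smul_eq_mul] at h
    rw [inv_mul_eq_iff_eq_mul₀ hl0] at h
    rw [← h]
    simp [origin]
  have c0 : A 0 2 = 0 := by simpa [origin] using hcol 0
  have c1 : A 1 2 = 0 := by simpa [origin] using hcol 1
  have c2 : A 2 2 = l := by simpa [origin] using hcol 2
  have c3 : A 3 2 = 0 := by simpa [origin] using hcol 3
  have hUU : Aᴴ * A = 1 := (Matrix.mem_unitaryGroup_iff').1 hU
  have hUU' : A * Aᴴ = 1 := (Matrix.mem_unitaryGroup_iff).1 hU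
  -- The third column of `A` is `λ e₃`. Unitarity clears the third row, the symplectic condition
  -- clears the fourth row, and unitarity again clears the fourth column.
  have r2 : ∀ j, j ≠ 2 → A 2 j = 0 := by
    intro j hj
    have h := congrFun (congrFun hUU j) 2
    rw [Matrix.one_apply_ne hj] at h
    simpa [Matrix.mul_apply, Fin.sum_univ_four, c0, c1, c2, c3, hl0] using h
  have hJ2 : ∀ j, A 3 j * l = J j 2 := by
    intro j
    have h := congrFun (congrFun hJ j) 2
    rw [← h]
    simp [Matrix.mul_apply, Fin.sum_univ_four, J, c0, c1, c2, c3]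
  have r30 : A 3 0 = 0 := by simpa [J, hl0] using hJ2 0
  have r31 : A 3 1 = 0 := by simpa [J, hl0] using hJ2 1
  have r33 : A 3 3 ≠ 0 := fun h => by simpa [J, h] using hJ2 3
  have c4 : ∀ i, i ≠ 3 → A i 3 = 0 := by
    intro i hi
    have h := congrFun (congrFun hUU' i) 3
    rw [Matrix.one_apply_ne hi] at h
    simpa [Matrix.mul_apply, Fin.sum_univ_four, r30, r31, c3, r33] using h
  constructor
  · ext i j
    fin_cases i <;> fin_cases j <;>
      simp [proj₃, Matrix.mul_apply, Fin.sum_univ_four, c0, c1, c3, r2]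
  · ext i j
    fin_cases i <;> fin_cases j <;>
      simp [proj₄, Matrix.mul_apply, Fin.sum_univ_four, r30, r31, c3, c4]

/-- Conjugation by an invertible matrix. -/
def conjHom {A B : Matrix (Fin 4) (Fin 4) ℂ} (hAB : A * B = 1) (hBA : B * A = 1) :
    Matrix (Fin 4) (Fin 4) ℂ →ₐ[ℂ] Matrix (Fin 4) (Fin 4) ℂ where
  toFun X := A * X * B
  map_one' := by rw [Matrix.mul_one, hAB]
  map_mul' X Y := by
    rw [Matrix.mul_assoc (A * X), ← Matrix.mul_assoc B, ← Matrix.mul_assoc B, hBA, Matrix.one_mul]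
    simp only [Matrix.mul_assoc]
  map_zero' := by simp
  map_add' X Y := by rw [Matrix.mul_add, Matrix.add_mul]
  commutes' r := by
    rw [Algebra.algebraMap_eq_smul_one, Matrix.mul_smul, Matrix.smul_mul, Matrix.mul_one, hAB]

/-- This and the next two identities express `z₁`, `α₃`, `α₁` by the matrix of `y` and the two
projections alone. Conjugation by `H` fixes the projections, hence these three quantities. -/
theorem proj_mul_mVec_mul_proj (y : M) :
    proj₃ * (mVec y).1 * proj₃ = (Complex.I * y.2 0) • proj₃ := by
  ext i j
  fin_cases i <;> fin_cases j <;>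
    simp [proj₃, mVec, spMatrix, Matrix.mul_apply, Fin.sum_univ_four]

theorem alpha_two_smul_proj (y : M) :
    proj₃ * (mVec y).1 * proj₄ * (mVec y).1 * proj₃ = (-(alpha 2 y : ℂ)) • proj₃ := by
  ext i j
  fin_cases i <;> fin_cases j <;>
    simp [proj₃, proj₄, mVec, spMatrix, alpha, Matrix.mul_apply, Fin.sum_univ_four]
  linear_combination (y.2 2 : ℂ) ^ 2 * Complex.I_sq

theorem alpha_zero_smul_proj (y : M) :
    proj₃ * (mVec y).1 * (1 - proj₃ - proj₄) * (mVec y).1 * proj₃ =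
      (-(alpha 0 y : ℂ)) • proj₃ := by
  have h1 : (1 - proj₃ - proj₄ : Matrix (Fin 4) (Fin 4) ℂ) =
      !![1, 0, 0, 0; 0, 1, 0, 0; 0, 0, 0, 0; 0, 0, 0, 0] := by
    ext i j
    fin_cases i <;> fin_cases j <;> simp [proj₃, proj₄]
  rw [h1]
  ext i j
  fin_cases i <;> fin_cases j <;>
    simp [proj₃, mVec, spMatrix, alpha, Matrix.mul_apply, Fin.sum_univ_four]
  linear_combination ((y.1 1 : ℂ) ^ 2 + (y.1 3 : ℂ) ^ 2) * Complex.I_sq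

/-- The numerators of the first three components of the explicit graph. -/
def graphNumerator (c : Fin 3 → ℝ) (y : M) : Fin 3 → ℝ :=
  ![K₁ c * y.2 0 * (y.1 0 ^ 2 + y.1 1 ^ 2 - y.1 2 ^ 2 - y.1 3 ^ 2)
        + 2 * K₂ c * (y.2 1 * (y.1 1 * y.1 2 - y.1 0 * y.1 3)
          + y.2 2 * (y.1 0 * y.1 2 + y.1 1 * y.1 3)),
    2 * K₁ c * y.2 0 * (y.1 1 * y.1 2 + y.1 0 * y.1 3)
        + K₂ c * (y.2 1 * (y.1 0 ^ 2 - y.1 1 ^ 2 + y.1 2 ^ 2 - y.1 3 ^ 2)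
          + 2 * y.2 2 * (y.1 2 * y.1 3 - y.1 0 * y.1 1)),
    2 * K₁ c * y.2 0 * (y.1 1 * y.1 3 - y.1 0 * y.1 2)
        + K₂ c * (2 * y.2 1 * (y.1 0 * y.1 1 + y.1 2 * y.1 3)
          + y.2 2 * (y.1 0 ^ 2 - y.1 1 ^ 2 - y.1 2 ^ 2 + y.1 3 ^ 2))]

/-- The middle factor in the coordinate-free form of the explicit graph. -/
def graphKernel (c : Fin 3 → ℝ) (P : Matrix (Fin 4) (Fin 4) ℂ) (z : ℂ) :
    Matrix (Fin 4) (Fin 4) ℂ :=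
  (K₂ c : ℂ) • ((proj₃ + proj₄) * P * (proj₃ + proj₄)) +
    (((K₁ c - K₂ c : ℝ) : ℂ) * z * Complex.I) • (proj₃ - proj₄)

/-- The coordinate-free form of the explicit graph. -/
def graphMatrix (c : Fin 3 → ℝ) (P : Matrix (Fin 4) (Fin 4) ℂ) (N z : ℂ) :
    Matrix (Fin 4) (Fin 4) ℂ :=
  -N⁻¹ • (((1 - proj₃ - proj₄) * P) * graphKernel c P z * (P * (1 - proj₃ - proj₄))) +
    ((K₃ c : ℂ) * z * Complex.I) • (proj₃ - proj₄)

theorem graphKernel_eq (c : Fin 3 → ℝ) (y : M) :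
    graphKernel c (mVec y).1 (y.2 0) = spMatrix 0 0 ![K₁ c * y.2 0, K₂ c * y.2 1, K₂ c * y.2 2] := by
  have h1 : (proj₃ + proj₄ : Matrix (Fin 4) (Fin 4) ℂ) =
      !![0, 0, 0, 0; 0, 0, 0, 0; 0, 0, 1, 0; 0, 0, 0, 1] := by
    ext i j
    fin_cases i <;> fin_cases j <;> simp [proj₃, proj₄]
  rw [graphKernel, h1]
  ext i j
  fin_cases i <;> fin_cases j <;>
    simp [proj₃, proj₄, mVec, spMatrix] <;> ring

/-- The off-diagonal blocks of the matrix of `y` are `B` and `-B*`, where `B` is the quaternion `x`.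
The product is thus `-B D B*` with `D` the imaginary quaternion `(K₁ z₁, K₂ z₂, K₂ z₃)`: the first
three components of the graph are `D` conjugated by `x / |x|`. -/
theorem graphNumerator_eq (c : Fin 3 → ℝ) (y : M) :
    ((1 - proj₃ - proj₄) * (mVec y).1) * graphKernel c (mVec y).1 (y.2 0) *
      ((mVec y).1 * (1 - proj₃ - proj₄)) = -spMatrix (graphNumerator c y) 0 0 := by
  have h1 : (1 - proj₃ - proj₄ : Matrix (Fin 4) (Fin 4) ℂ) =
      !![1, 0, 0, 0; 0, 1, 0, 0; 0, 0, 0, 0; 0, 0, 0, 0] := by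
    ext i j
    fin_cases i <;> fin_cases j <;> simp [proj₃, proj₄]
  rw [graphKernel_eq, h1]
  ext i j
  fin_cases i <;> fin_cases j <;>
    simp [mVec, spMatrix, graphNumerator, Matrix.mul_apply, Fin.sum_univ_four] <;>
    apply Complex.ext <;> simp [pow_two] <;> ring

theorem hVec_explicitGraph (c : Fin 3 → ℝ) (y : M) :
    hVec (explicitGraph c y) = (graphMatrix c (mVec y).1 (alpha 0 y) (y.2 0), K₃ c * y.2 0) := by
  refine Prod.ext ?_ (by simp [hVec, explicitGraph])
  rw [graphMatrix, graphNumerator_eq]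
  ext i j
  fin_cases i <;> fin_cases j <;>
    simp [hVec, spMatrix, explicitGraph, graphNumerator, alpha, proj₃, proj₄] <;> ring

/-- Conjugation by `σ ∈ H` is an algebra automorphism fixing `proj₃` and `proj₄`. It therefore
commutes with any expression built from these, the matrix of `y` and invariant scalars, and
`graphMatrix` is such an expression. -/
theorem alpha_eq_and_explicitGraph_equivariant {σ : Matrix (Fin 4) (Fin 4) ℂ × ℂ} (hσ : σ ∈ H)
    {y y' : M} (h : Ad σ (mVec y) = mVec y') :
    (∀ i, alpha i y' = alpha i y) ∧
      ∀ c, Ad σ (hVec (explicitGraph c y)) = hVec (explicitGraph c y') := by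
  obtain ⟨h3, h4⟩ := commute_proj_of_mem_H hσ
  have hu : IsUnit σ.1.det := by
    refine (Matrix.isUnit_iff_isUnit_det _).1 (IsUnit.of_mul_eq_one (star σ.1) ?_)
    exact Matrix.mem_unitaryGroup_iff.1 hσ.1.1
  set T := conjHom (Matrix.mul_nonsing_inv σ.1 hu) (Matrix.nonsing_inv_mul σ.1 hu) with hT
  have hTdef : ∀ X, T X = σ.1 * X * σ.1⁻¹ := fun _ => rfl
  have hT3 : T proj₃ = proj₃ := by
    rw [hTdef, h3, Matrix.mul_assoc, Matrix.mul_nonsing_inv _ hu, Matrix.mul_one]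
  have hT4 : T proj₄ = proj₄ := by
    rw [hTdef, h4, Matrix.mul_assoc, Matrix.mul_nonsing_inv _ hu, Matrix.mul_one]
  have hP : T (mVec y).1 = (mVec y').1 := congrArg Prod.fst h
  have hcancel : ∀ r s : ℂ, r • proj₃ = s • proj₃ → r = s := fun r s hrs => by
    simpa [proj₃] using congrFun (congrFun hrs 2) 2
  have hz : y.2 0 = y'.2 0 := by
    have e := congrArg T (proj_mul_mVec_mul_proj y)
    rw [map_mul, map_mul, map_smul, hT3, hP, proj_mul_mVec_mul_proj] at e
    simpa using (hcancel _ _ e).symm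
  have h0 : alpha 0 y' = alpha 0 y := by
    have e := congrArg T (alpha_zero_smul_proj y)
    rw [map_mul, map_mul, map_mul, map_mul, map_smul, map_sub, map_sub, map_one, hT3, hT4, hP,
      alpha_zero_smul_proj] at e
    simpa using hcancel _ _ e
  have h2 : alpha 2 y' = alpha 2 y := by
    have e := congrArg T (alpha_two_smul_proj y)
    rw [map_mul, map_mul, map_mul, map_mul, map_smul, hT3, hT4, hP, alpha_two_smul_proj] at e
    simpa using hcancel _ _ e
  refine ⟨fun i => ?_, fun c => ?_⟩
  · fin_cases i
    · exact h0
    · simp [alpha, hz]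
    · exact h2
  · rw [hVec_explicitGraph, hVec_explicitGraph, Ad, ← hTdef, h0, ← hz]
    refine Prod.ext ?_ rfl
    simp only [graphMatrix, graphKernel, map_add, map_smul, map_mul, map_sub, map_one, hT3, hT4, hP]

/-- At `x = 0` the values of an equivariant map have no component in `sp(1)`. -/
theorem eq_zero_of_equivariant {F : M → ℝ} {ξ : M → Fin 4 → ℝ} (hξ : IsGeodesicGraph F ξ) {y : M}
    (hy : y.1 = 0) : ξ y 0 = 0 ∧ ξ y 1 = 0 ∧ ξ y 2 = 0 := by
  -- `A` and `B` are the unit quaternions `i` and `j` in `Sp(1)`. Both fix every `y` with `x = 0`,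
  -- hence also the value `ξ y`; an imaginary quaternion commuting with both is zero.
  set A : Matrix (Fin 4) (Fin 4) ℂ :=
    !![Complex.I, 0, 0, 0; 0, -Complex.I, 0, 0; 0, 0, 1, 0; 0, 0, 0, 1] with hA
  set A' : Matrix (Fin 4) (Fin 4) ℂ :=
    !![-Complex.I, 0, 0, 0; 0, Complex.I, 0, 0; 0, 0, 1, 0; 0, 0, 0, 1] with hA'
  set B : Matrix (Fin 4) (Fin 4) ℂ :=
    !![0, -1, 0, 0; 1, 0, 0, 0; 0, 0, 1, 0; 0, 0, 0, 1] with hB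
  set B' : Matrix (Fin 4) (Fin 4) ℂ :=
    !![0, 1, 0, 0; -1, 0, 0, 0; 0, 0, 1, 0; 0, 0, 0, 1] with hB'
  have hAi : A⁻¹ = A' := Matrix.inv_eq_right_inv (by
    ext i j
    fin_cases i <;> fin_cases j <;> simp [hA, hA', Matrix.mul_apply, Fin.sum_univ_four])
  have hBi : B⁻¹ = B' := Matrix.inv_eq_right_inv (by
    ext i j
    fin_cases i <;> fin_cases j <;> simp [hB, hB', Matrix.mul_apply, Fin.sum_univ_four])
  have hAH : (A, (1 : ℂ)) ∈ H := by
    refine ⟨⟨Matrix.mem_unitaryGroup_iff'.2 ?_, ?_, by simp⟩, ?_⟩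
    · ext i j
      fin_cases i <;> fin_cases j <;>
        simp [hA, Matrix.star_eq_conjTranspose, Matrix.mul_apply, Fin.sum_univ_four]
    · ext i j
      fin_cases i <;> fin_cases j <;> simp [hA, J, Matrix.mul_apply, Fin.sum_univ_four]
    · ext i
      fin_cases i <;> simp [act, hA, origin_eq]
  have hBH : (B, (1 : ℂ)) ∈ H := by
    refine ⟨⟨Matrix.mem_unitaryGroup_iff'.2 ?_, ?_, by simp⟩, ?_⟩
    · ext i j
      fin_cases i <;> fin_cases j <;>
        simp [hB, Matrix.star_eq_conjTranspose, Matrix.mul_apply, Fin.sum_univ_four]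
    · ext i j
      fin_cases i <;> fin_cases j <;> simp [hB, J, Matrix.mul_apply, Fin.sum_univ_four]
    · ext i
      fin_cases i <;> simp [act, hB, origin_eq]
  have h1 := hξ.1 _ hAH y y (by
    rw [Ad, hAi]
    refine Prod.ext ?_ rfl
    ext i j
    fin_cases i <;> fin_cases j <;>
      simp [hA, hA', mVec, hy, spMatrix, Matrix.mul_apply, Fin.sum_univ_four])
  have h2 := hξ.1 _ hBH y y (by
    rw [Ad, hBi]
    refine Prod.ext ?_ rfl
    ext i j
    fin_cases i <;> fin_cases j <;>
      simp [hB, hB', mVec, hy, spMatrix, Matrix.mul_apply, Fin.sum_univ_four])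
  rw [Ad, hAi] at h1
  rw [Ad, hBi] at h2
  have e1 := congrFun (congrFun (congrArg Prod.fst h1) 0) 1
  have e2 := congrFun (congrFun (congrArg Prod.fst h2) 0) 0
  simp [hA, hA', hVec, spMatrix, Matrix.mul_apply, Fin.sum_univ_four, Complex.ext_iff] at e1
  simp [hB, hB', hVec, spMatrix, Matrix.mul_apply, Fin.sum_univ_four, Complex.ext_iff] at e2
  refine ⟨by linarith, by linarith [e1.1], by linarith [e1.2]⟩

/-! ### Continuity -/

theorem continuousOn_explicitGraph {C : M → Fin 3 → ℝ} (hC : ContinuousOn C {y | y.1 ≠ 0})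
    (hpos : ∀ y, y ≠ 0 → ∀ i, 0 < C y i) :
    ContinuousOn (fun y => explicitGraph (C y) y) {y | y.1 ≠ 0} := by
  have hCi := continuousOn_pi.1 hC
  have hne : ∀ i, ∀ y ∈ {y : M | y.1 ≠ 0}, C y i ≠ 0 := fun i y hy =>
    (hpos y (fun h => hy (by rw [h]; rfl)) i).ne'
  have hN : ∀ y ∈ {y : M | y.1 ≠ 0}, y.1 0 ^ 2 + y.1 1 ^ 2 + y.1 2 ^ 2 + y.1 3 ^ 2 ≠ 0 :=
    fun y hy => (sum_sq_pos hy).ne'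
  have d12 := (hCi 1).div (hCi 2) (hne 2)
  have d10 := (hCi 1).div (hCi 0) (hne 0)
  have d20 := (hCi 2).div (hCi 0) (hne 0)
  have k1 : ContinuousOn (fun y => K₁ (C y)) {y | y.1 ≠ 0} :=
    d12.sub (continuousOn_const.mul d10)
  have k2 : ContinuousOn (fun y => K₂ (C y)) {y | y.1 ≠ 0} :=
    continuousOn_const.sub (continuousOn_const.mul d20)
  have k3 : ContinuousOn (fun y => K₃ (C y)) {y | y.1 ≠ 0} := d12.sub continuousOn_const
  refine continuousOn_pi.2 fun i => ?_
  fin_cases i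
  · exact ContinuousOn.div (by fun_prop) (by fun_prop) hN
  · exact ContinuousOn.div (by fun_prop) (by fun_prop) hN
  · exact ContinuousOn.div (by fun_prop) (by fun_prop) hN
  · exact k3.mul (by fun_prop)

theorem continuous_alpha : Continuous fun y : M => fun i => alpha i y := by
  refine continuous_pi fun i => ?_
  fin_cases i <;> simp [alpha] <;> fun_prop

/-! ### The unique geodesic graph -/

/-- Maps that are continuous on `{x ≠ 0}` and agree where `(z₂, z₃) ≠ (0, 0)` agree on
`{x ≠ 0}`. -/
theorem eq_of_continuousOn {ξ η : M → Fin 4 → ℝ} (hξ : ContinuousOn ξ {y | y.1 ≠ 0})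
    (hη : ContinuousOn η {y | y.1 ≠ 0})
    (h : ∀ y : M, (y.2 1 ≠ 0 ∨ y.2 2 ≠ 0) → ξ y = η y) {y : M} (hy : y.1 ≠ 0) : ξ y = η y := by
  by_cases hz : y.2 1 = 0
  -- Replacing `z₂ = 0` by `s ≠ 0` keeps `x` and reaches the region where the maps agree; then `s →
  -- 0`.
  · set p : ℝ → M := fun s => (y.1, Function.update y.2 1 s) with hp
    have hp0 : p 0 = y := by
      simp only [hp]
      rw [← hz, Function.update_eq_self]
    have hpc : Continuous p := by simp only [hp]; fun_prop
    have hopen : IsOpen {y : M | y.1 ≠ 0} := isOpen_ne_fun continuous_fst continuous_const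
    have key : ∀ ζ : M → Fin 4 → ℝ, ContinuousOn ζ {y | y.1 ≠ 0} →
        Filter.Tendsto (fun s => ζ (p s)) (nhdsWithin 0 {0}ᶜ) (nhds (ζ y)) := by
      intro ζ hζ
      have h1 : ContinuousAt ζ (p 0) := by rw [hp0]; exact hζ.continuousAt (hopen.mem_nhds hy)
      have h2 : ContinuousAt (fun s => ζ (p s)) 0 := h1.comp hpc.continuousAt
      have h3 := h2.tendsto.mono_left (nhdsWithin_le_nhds (s := {0}ᶜ))
      simpa only [hp0] using h3
    refine tendsto_nhds_unique (key ξ hξ) ((key η hη).congr' ?_)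
    filter_upwards [self_mem_nhdsWithin] with s hs
    exact (h (p s) (Or.inl (by simpa [hp] using hs))).symm
  · exact h y (Or.inl hz)

theorem explicitGraph_zero (c : Fin 3 → ℝ) : explicitGraph c 0 = 0 := by
  ext i
  fin_cases i <;> simp [explicitGraph]

/-- Common argument for the Finsler and the Riemannian case: only `C`, the gradient of the profile,
matters. It is continuous because `φ` is `C¹`, and `H`-invariant because it depends on `y` through
the `α_i` only. -/
theorem isUniqueGeodesicGraph_explicitGraph {F : M → ℝ} {φ : (Fin 3 → ℝ) → ℝ}
    {U : Set (Fin 3 → ℝ)} (hF : HasProfile F φ U) {C : M → Fin 3 → ℝ}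
    (hC : ∀ y, y ≠ 0 → ∀ i, fderiv ℝ φ (fun i => alpha i y) (Pi.single i 1) = C y i)
    (hpos : ∀ y, y ≠ 0 → ∀ i, 0 < C y i) :
    IsUniqueGeodesicGraph F (fun y => explicitGraph (C y) y) := by
  have hx0 : ∀ y : M, y.1 ≠ 0 → y ≠ 0 := fun y hy h => hy (by rw [h]; rfl)
  have hz0 : ∀ y : M, (y.2 1 ≠ 0 ∨ y.2 2 ≠ 0) → y ≠ 0 := fun y hy h => by simp [h] at hy
  have hCc : ContinuousOn C {y | y.1 ≠ 0} := by
    refine continuousOn_pi.2 fun i => ?_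
    have h1 : ContinuousOn (fun y : M => fderiv ℝ φ (fun i => alpha i y)) {y | y.1 ≠ 0} :=
      (hF.contDiffOn.continuousOn_fderiv_of_isOpen hF.isOpen le_rfl).comp
        continuous_alpha.continuousOn fun y hy => hF.alpha_mem y (hx0 y hy)
    exact (h1.clm_apply continuousOn_const).congr fun y hy => (hC y (hx0 y hy) i).symm
  have hcont := continuousOn_explicitGraph hCc hpos
  have hsol : ∀ y, y ≠ 0 → eulerCoeff (C y) y (explicitGraph (C y) y) = 0 := fun y hy =>
    eulerCoeff_explicitGraph (hpos y hy) y
  have huniq : ∀ y : M, y.1 ≠ 0 → (y.2 1 ≠ 0 ∨ y.2 2 ≠ 0) → ∀ ζ : Fin 4 → ℝ,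
      IsGeodesicVector F (mVec y + hVec ζ) → ζ = explicitGraph (C y) y := by
    intro y hx hz ζ hζ
    have hy := hx0 y hx
    have h := (isGeodesicVector_iff hF hy ζ (hC y hy)).1 hζ
    exact eq_of_eulerCoeff (hpos y hy) h (hsol y hy) hx (eq_K₃_of_eulerCoeff (hpos y hy) h hz)
  refine ⟨⟨fun σ hσ y y' h => ?_, fun y hy => ?_⟩, hcont, huniq, fun ξ hξ => ?_⟩
  · obtain ⟨h1, h2⟩ := alpha_eq_and_explicitGraph_equivariant hσ h
    have hα : (fun i => alpha i y') = fun i => alpha i y := funext h1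
    simp only [h2]
    -- Nothing is known about `C` at `0`, but the explicit graph vanishes there for every choice of
    -- constants.
    by_cases hy' : y' = 0
    · rw [hy', explicitGraph_zero, explicitGraph_zero]
    · have hy : y ≠ 0 := by
        rintro rfl
        refine hy' ?_
        have a0 := h1 0
        have a1 := h1 1
        have a2 := h1 2
        simp [alpha] at a0 a1 a2
        have hx' : y'.1 = 0 := by
          by_contra hne
          exact (sum_sq_pos hne).ne' a0
        refine Prod.ext hx' (funext fun i => ?_)
        fin_cases i
        · exact a1
        · simp; nlinarith [sq_nonneg (y'.2 1), sq_nonneg (y'.2 2)]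
        · simp; nlinarith [sq_nonneg (y'.2 1), sq_nonneg (y'.2 2)]
      have : C y' = C y := funext fun i => by rw [← hC y hy, ← hC y' hy', hα]
      rw [this]
  · exact (isGeodesicVector_iff hF hy _ (hC y hy)).2 (hsol y hy)
  · have hall : ∀ y : M, (y.2 1 ≠ 0 ∨ y.2 2 ≠ 0) → ξ y = explicitGraph (C y) y := by
      intro y hz
      have hy := hz0 y hz
      by_cases hx : y.1 = 0
      · have h := (isGeodesicVector_iff hF hy (ξ y) (hC y hy)).1 (hξ.2 y hy)
        obtain ⟨h0, h1, h2⟩ := eq_zero_of_equivariant hξ hx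
        have h3 := eq_K₃_of_eulerCoeff (hpos y hy) h hz
        ext i
        fin_cases i
        · simpa [explicitGraph, hx] using h0
        · simpa [explicitGraph, hx] using h1
        · simpa [explicitGraph, hx] using h2
        · simpa [explicitGraph] using h3
      · exact huniq y hx hz _ (hξ.2 y hy)
    exact ⟨hall, fun hc y hy => eq_of_continuousOn hc hcont hall hy⟩

/-! ### The metrics -/

theorem alpha_nonneg (i : Fin 3) (y : M) : 0 ≤ alpha i y := by
  fin_cases i <;> simp [alpha] <;> positivity

theorem exists_alpha_pos {y : M} (hy : y ≠ 0) : ∃ i, 0 < alpha i y := by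
  by_cases hx : y.1 = 0
  · have hz : y.2 ≠ 0 := fun h => hy (Prod.ext hx h)
    obtain ⟨i, hi⟩ := Function.ne_iff.1 hz
    have hi : y.2 i ≠ 0 := hi
    fin_cases i
    · exact ⟨1, by simp [alpha] at hi ⊢; positivity⟩
    · exact ⟨2, by simp [alpha] at hi ⊢; positivity⟩
    · exact ⟨2, by simp [alpha] at hi ⊢; positivity⟩
  · exact ⟨0, by simpa [alpha] using sum_sq_pos hx⟩

theorem gForm_pos {c : Fin 3 → ℝ} (hc : ∀ i, 0 < c i) {y : M} (hy : y ≠ 0) : 0 < gForm c y := by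
  obtain ⟨i, hi⟩ := exists_alpha_pos hy
  exact Finset.sum_pos' (fun i _ => mul_nonneg (hc i).le (alpha_nonneg i y))
    ⟨i, Finset.mem_univ i, mul_pos (hc i) hi⟩

theorem gForm_nonneg {c : Fin 3 → ℝ} (hc : ∀ i, 0 < c i) (y : M) : 0 ≤ gForm c y :=
  Finset.sum_nonneg fun i _ => mul_nonneg (hc i).le (alpha_nonneg i y)

theorem norms_pos {k : ℕ} {a : Fin k → Fin 3 → ℝ} (ha : ∀ j i, 0 < a j i) {y : M} (hy : y ≠ 0)
    (j : Fin k) : 0 < norms a y j :=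
  Real.sqrt_pos.2 (gForm_pos (ha j) hy)

/-- All summands are nonnegative, and some `L_{,j}` is positive because their sum is; all entries of
`a` are positive, so that `j` contributes to every `C_i`. -/
theorem coeffC_pos {k : ℕ} {L : (Fin k → ℝ) → ℝ} {a : Fin k → Fin 3 → ℝ} (hL : IsAdmissible L)
    (ha : ∀ j i, 0 < a j i) {y : M} (hy : y ≠ 0) (i : Fin 3) : 0 < coeffC L a y i := by
  have hn := norms_pos ha hy
  have hp := hL.partialDeriv_nonneg _ hn
  obtain ⟨j, -, hj⟩ := Finset.exists_lt_of_sum_lt (s := Finset.univ) (f := fun _ => (0 : ℝ))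
    (g := fun j => partialDeriv L j (norms a y)) (by simpa using hL.sum_partialDeriv_pos _ hn)
  refine Finset.sum_pos' (fun j _ => mul_nonneg (div_nonneg (hp j) ?_) (ha j i).le)
    ⟨j, Finset.mem_univ j, mul_pos (div_pos hj ?_) (ha j i)⟩
  · linarith [hn j]
  · linarith [hn j]

theorem finslerNorm_sq {k : ℕ} {L : (Fin k → ℝ) → ℝ} {a : Fin k → Fin 3 → ℝ}
    (hL : IsAdmissible L) (ha : ∀ j i, 0 < a j i) (y : M) :
    finslerNorm L a y ^ 2 = L (norms a y) := by
  refine Real.sq_sqrt ?_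
  by_cases hy : y = 0
  · have h0 : norms a y = 0 := by
      ext j
      simp [norms, riemannianNorm, gForm, hy, alpha, Fin.sum_univ_three]
    -- Homogeneity with factor `2` gives `L 0 = 4 L 0`, hence `L 0 = 0`.
    have h1 := hL.homogeneous 0 (fun _ => le_rfl) 2 two_pos
    rw [smul_zero] at h1
    rw [h0]
    linarith
  · exact (hL.pos _ (norms_pos ha hy)).le

theorem hasProfile_finslerNorm {k : ℕ} {L : (Fin k → ℝ) → ℝ} {a : Fin k → Fin 3 → ℝ}
    (hL : IsAdmissible L) (ha : ∀ j i, 0 < a j i) :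
    HasProfile (finslerNorm L a) (fun α => L fun j => √(∑ i, a j i * α i))
      {α | ∀ j, 0 < ∑ i, a j i * α i} where
  isOpen := by
    simp only [Set.ofPred_forall]
    exact isOpen_iInter_of_finite fun j => isOpen_lt continuous_const (by fun_prop)
  contDiffOn := by
    refine (hL.contDiffOn.of_le (by exact_mod_cast le_top)).comp ?_ fun α hα j =>
      Real.sqrt_pos.2 (hα j)
    refine contDiffOn_pi.2 fun j => ContDiffOn.sqrt ?_ fun α hα => (hα j).ne'
    fun_prop
  sq_eq y := finslerNorm_sq hL ha y
  alpha_mem y hy j := gForm_pos (ha j) hy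

/-- Since `g_j` is linear in the `α_i` with coefficients `a_{ji}`, the derivative of `√g_j` in `α_i`
is `a_{ji} / (2 √g_j)`; summing against `L_{,j}` gives exactly `C_i`. -/
theorem fderiv_profile {k : ℕ} {L : (Fin k → ℝ) → ℝ} {a : Fin k → Fin 3 → ℝ}
    (hL : IsAdmissible L) (ha : ∀ j i, 0 < a j i) {y : M} (hy : y ≠ 0) (i : Fin 3) :
    fderiv ℝ (fun α : Fin 3 → ℝ => L fun j => √(∑ i, a j i * α i)) (fun i => alpha i y)
      (Pi.single i 1) = coeffC L a y i := by
  have hF := hasProfile_finslerNorm hL ha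
  set α₀ : Fin 3 → ℝ := fun i => alpha i y with hα₀
  have hφ : HasFDerivAt (fun α : Fin 3 → ℝ => L fun j => √(∑ i, a j i * α i))
      (fderiv ℝ (fun α : Fin 3 → ℝ => L fun j => √(∑ i, a j i * α i)) α₀) α₀ :=
    ((hF.contDiffOn.contDiffAt (hF.isOpen.mem_nhds (hF.alpha_mem y hy))).differentiableAt
      one_ne_zero).hasFDerivAt
  have hline : HasDerivAt (fun s : ℝ => α₀ + s • (Pi.single i 1 : Fin 3 → ℝ)) (Pi.single i 1) 0 := by
    simpa using ((hasDerivAt_id (0 : ℝ)).smul_const (Pi.single i 1 : Fin 3 → ℝ)).const_add α₀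
  have hφ' : HasFDerivAt (fun α : Fin 3 → ℝ => L fun j => √(∑ i, a j i * α i))
      (fderiv ℝ (fun α : Fin 3 → ℝ => L fun j => √(∑ i, a j i * α i)) α₀)
      (α₀ + (0 : ℝ) • (Pi.single i 1 : Fin 3 → ℝ)) := by simpa using hφ
  have h1 := hφ'.comp_hasDerivAt (0 : ℝ) hline
  have hopen : IsOpen {t : Fin k → ℝ | ∀ j, 0 < t j} := by
    simp only [Set.ofPred_forall]
    exact isOpen_iInter_of_finite fun j => isOpen_lt continuous_const (continuous_apply j)
  have hn := norms_pos ha hy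
  have hLd : HasFDerivAt L (fderiv ℝ L (norms a y)) (norms a y) :=
    ((hL.contDiffOn.contDiffAt (hopen.mem_nhds hn)).differentiableAt (by simp)).hasFDerivAt
  have hr : HasDerivAt
      (fun s : ℝ => fun j => √(∑ l, a j l * (α₀ + s • (Pi.single i 1 : Fin 3 → ℝ)) l))
      (fun j => a j i / (2 * norms a y j)) 0 := by
    refine hasDerivAt_pi.2 fun j => ?_
    have hs : HasDerivAt (fun s : ℝ => gForm (a j) y + s * a j i) (1 * a j i) 0 :=
      ((hasDerivAt_id (0 : ℝ)).mul_const (a j i)).const_add _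
    have hs' := hs.sqrt (by simpa using (gForm_pos (ha j) hy).ne')
    refine (hs'.congr_deriv ?_).congr_of_eventuallyEq (Filter.Eventually.of_forall fun s => ?_)
    · simp [norms, riemannianNorm]
    · simp only [gForm, hα₀, Pi.add_apply, Pi.smul_apply, smul_eq_mul, mul_add,
        Finset.sum_add_distrib]
      congr 2
      simp [Pi.single_apply, mul_comm]
  have hn0 : (fun j => √(∑ l, a j l * (α₀ + (0 : ℝ) • (Pi.single i 1 : Fin 3 → ℝ)) l)) =
      norms a y := by
    ext j
    simp [norms, riemannianNorm, gForm, hα₀]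
  rw [← hn0] at hLd
  have h2 := hLd.comp_hasDerivAt (0 : ℝ) hr
  rw [h1.unique h2, hn0]
  have hlin : ∀ d : Fin k → ℝ, fderiv ℝ L (norms a y) d =
      ∑ j, d j * partialDeriv L j (norms a y) := by
    intro d
    conv_lhs => rw [pi_eq_sum_univ' d]
    simp [partialDeriv]
  rw [hlin, coeffC]
  refine Finset.sum_congr rfl fun j _ => ?_
  rw [coeffB]
  ring

theorem hasProfile_riemannianNorm {c : Fin 3 → ℝ} (hc : ∀ i, 0 < c i) :
    HasProfile (riemannianNorm c) (fun α => ∑ i, c i * α i) Set.univ where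
  isOpen := isOpen_univ
  contDiffOn := by fun_prop
  sq_eq y := Real.sq_sqrt (gForm_nonneg hc y)
  alpha_mem _ _ := Set.mem_univ _

theorem fderiv_sum_mul (c α : Fin 3 → ℝ) (i : Fin 3) :
    fderiv ℝ (fun α : Fin 3 → ℝ => ∑ i, c i * α i) α (Pi.single i 1) = c i := by
  have h : HasFDerivAt (fun α : Fin 3 → ℝ => ∑ i, c i * α i)
      (∑ i, c i • (ContinuousLinearMap.proj i : (Fin 3 → ℝ) →L[ℝ] ℝ)) α :=
    HasFDerivAt.fun_sum fun i _ => (hasFDerivAt_apply i α).const_mul (c i)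
  rw [h.fderiv]
  simp [Pi.single_apply]

end SevenSphere

end

theorem mainTheorem4 :
    (∀ (k : ℕ) (L : (Fin k → ℝ) → ℝ) (a : Fin k → Fin 3 → ℝ),
      SevenSphere.IsAdmissible L → (∀ j i, 0 < a j i) →
        (∀ y : SevenSphere.M, y ≠ 0 → ∀ i, 0 < SevenSphere.coeffC L a y i) ∧
        SevenSphere.IsUniqueGeodesicGraph (SevenSphere.finslerNorm L a)
          (fun y => SevenSphere.explicitGraph (SevenSphere.coeffC L a y) y)) ∧
    (∀ c : Fin 3 → ℝ, (∀ i, 0 < c i) →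
      SevenSphere.IsUniqueGeodesicGraph (SevenSphere.riemannianNorm c)
        (fun y => SevenSphere.explicitGraph c y)) := by
  refine ⟨fun k L a hL ha => ⟨fun y hy i => SevenSphere.coeffC_pos hL ha hy i, ?_⟩, fun c hc => ?_⟩
  · exact SevenSphere.isUniqueGeodesicGraph_explicitGraph
      (SevenSphere.hasProfile_finslerNorm hL ha)
      (fun y hy i => SevenSphere.fderiv_profile hL ha hy i)
      (fun y hy i => SevenSphere.coeffC_pos hL ha hy i)
  · exact SevenSphere.isUniqueGeodesicGraph_explicitGraph (C := fun _ => c)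
      (SevenSphere.hasProfile_riemannianNorm hc)
      (fun y _ i => SevenSphere.fderiv_sum_mul c _ i) (fun _ _ i => hc i)
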